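/- \textbf{Setting.} Let $m\ge 1$ and $[m]=\{1,\dots,m\}$. A \emph{couple} $ij|C$ over $[m]$ consists of a two-element set $ij=\{i,j\}\subseteq[m]$ and a set $C\subseteq[m]\setminus ij$ (we write $ij$ for $ij|\emptyset$ and write unions of index sets by concatenation); a \emph{relation} on $[m]$ is a set of couples. For a relation $\mathcal L$ let $$V_{pd}(\mathcal L)=\{\Sigma\in\mathbb R^{m\times m}\text{ symmetric positive definite}:\det(\Sigma_{iC,jC})=0\text{ for all }ij|C\in\mathcal L\},$$ the Gaussian conditional independence (CI) model of $\mathcal L$. The relation $\mathcal L$ is \emph{complete} if every couple $ij|C$ with $\det(\Sigma_{iC,jC})=0$ for all $\Sigma\in V_{pd}(\mathcal L)$ belongs to $\mathcal L$. A relation $\mathcal L$ \emph{satisfies} an implication $\mathcal L_1\Rightarrow\mathcal L_2$ between relations if $\mathcal L_1\subseteq\mathcal L$ implies $\mathcal L_2\subseteq\mathcal L$. The implication is a \emph{Gaussian CI implication} if $\mathcal L_1\cap\mathcal L_2=\emptyset$ and $V_{pd}(\mathcal L_1)=V_{pd}(\mathcal L_1\cup\mathcal L_2)$. The \emph{dual}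 of $ij|C$ is $ij|([m]\setminus ijC)$; the dual of an implication is obtained by replacing all couples by their duals. For $m=4$, let $\mathcal A$ be the set of the following implications. (1) For all distinct $i,j,k$ and $C\subseteq[4]\setminus ijk$: \begin{align*} \{ij|C,ik|C\}&\Rightarrow\{ij|kC,ik|jC\},\\ \{ij|C,ik|jC\}&\Rightarrow\{ik|C,ij|kC\},\\ \{ij|kC,ik|jC\}&\Rightarrow\{ij|C,ik|C\}. \end{align*} (2) For all distinct $i,j,k,l$ and $C\subseteq[4]\setminus ijkl$ (so $C=\emptyset$): \begin{align*} \{ij|C,kl|C,ik|jlC,jl|ikC\}&\Rightarrow\{ik|C\},\\ \{ij|C,kl|iC,kl|jC,ij|klC\}&\Rightarrow\{kl|C\},\\ \{ij|C,jl|kC,kl|iC,ik|jlC\}&\Rightarrow\{ik|C\},\\ \{ij|kC,ik|lC,il|jC\}&\Rightarrow\{ij|C\},\\ \{ij|kC,jk|lC,kl|iC,il|jC\}&\Rightarrow\{ij|C\}. \end{align*} (3) All implications obtained by a permutation of the indices $1,2,3,4$ from the following 13, and the duals of all these: \begin{align*} \{23|4,23|14,24|1,34|1\}&\Rightarrow\{23,23|1,24|13,34|12\},\\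 \{23,23|1,24|1,34|1\}&\Rightarrow\{23|4,23|14,24|13,34|12\},\\ \{14|2,14|3,14|23,23|14\}&\Rightarrow\{14\},\\ \{14,14|2,14|23,23|14\}&\Rightarrow\{14|3\},\\ \{14,14|2,14|3,23|14\}&\Rightarrow\{14|23\},\\ \{14,14|23,23|1,23|14\}&\Rightarrow\{14|2,14|3\},\\ \{14|2,14|3,23|1,23|14\}&\Rightarrow\{14,14|23\},\\ \{12,14|3,14|23,23|14\}&\Rightarrow\{12|3,12|4,12|34,23|4\},\\ \{12,14|3,23|4,23|14\}&\Rightarrow\{12|3,12|4,12|34,14|23\},\\ \{12|3,14|2,23|4,23|14\}&\Rightarrow\{12,12|4,12|34,14\},\\ \{12|3,14,14|2,23|14\}&\Rightarrow\{12,12|4,12|34,23|4\},\\ \{14|2,23|1,23|4,23|14\}&\Rightarrow\{23\},\\ \{14|2,23,23|1,23|14\}&\Rightarrow\{23|4\}. \end{align*} \textbf{Theorem.} A relation on $[4]$ is complete if and only if it satisfies all implications in $\mathcal A$. All implications in $\mathcal A$ are Gaussian CI implications, and $\mathcal A$ axiomatizes Gaussian conditional independence on four variables: for disjoint relations $\mathcal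 L_1,\mathcal L_2$ on $[4]$, $\mathcal L_1\Rightarrow\mathcal L_2$ is a Gaussian CI implication if and only if every couple of $\mathcal L_2$ can be deduced from the couples of $\mathcal L_1$ by finitely many applications of implications in $\mathcal A$. -/

import Mathlib

namespace GaussianCI

/-- A conditional independence couple `ij|C` over the ground set `Fin m`: a two-element set `ij`
(first component) and a conditioning set `C` disjoint from it (second component). -/
abbrev Couple (m : ℕ) : Type :=
  {c : Finset (Fin m) × Finset (Fin m) // c.1.card = 2 ∧ Disjoint c.1 c.2}

/-- A conditional independence relation over `Fin m`. -/
abbrev Relation (m : ℕ) : Type := Set (Couple m)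

/-- The couple `ij|C`. The side conditions are discharged automatically. -/
def couple {m : ℕ} (i j : Fin m) (C : Finset (Fin m))
    (hij : i ≠ j := by first | decide | grind)
    (hi : i ∉ C := by first | decide | grind)
    (hj : j ∉ C := by first | decide | grind) : Couple m :=
  ⟨({i, j}, C), Finset.card_pair hij, by
    simp [Finset.disjoint_insert_left, hi, hj]⟩

/-- The almost-principal minor `det (S_{iC,jC})`: the rows are `i` followed by `C`, the columns
are `j` followed by `C`. -/
noncomputable def minor {m : ℕ} (S : Matrix (Fin m) (Fin m) ℝ) (i j : Fin m)
    (C : Finset (Fin m)) : ℝ :=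
  (S.submatrix (fun o : Option C => o.elim i (fun c => (c : Fin m)))
    (fun o : Option C => o.elim j (fun c => (c : Fin m)))).det

/-- `det (S_{iC,jC}) = 0` for the couple `ij|C` (in both orders of `i` and `j`; for a symmetric
matrix the two minors coincide). -/
def Couple.HoldsAt {m : ℕ} (c : Couple m) (S : Matrix (Fin m) (Fin m) ℝ) : Prop :=
  ∀ i j : Fin m, c.1.1 = {i, j} → minor S i j c.1.2 = 0

/-- `V_pd(L)`: the positive definite matrices at which all couples of `L` hold. -/
def Vpd {m : ℕ} (L : Relation m) : Set (Matrix (Fin m) (Fin m) ℝ) :=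
  {S | S.PosDef ∧ ∀ c ∈ L, c.HoldsAt S}

/-- `L(W)`: the couples that hold at all matrices of `W`. -/
def relationOf {m : ℕ} (W : Set (Matrix (Fin m) (Fin m) ℝ)) : Relation m :=
  {c | ∀ S ∈ W, c.HoldsAt S}

/-- A relation `L` is complete if `L = L(V_pd(L))`. -/
def IsComplete {m : ℕ} (L : Relation m) : Prop := L = relationOf (Vpd L)

/-- A formal implication `premise ⟹ conclusion` between relations (not assumed to be valid). -/
@[ext]
structure Implication (m : ℕ) where
  premise : Relation m
  conclusion : Relation m

/-- `L` satisfies the implication `I`. -/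
def Satisfies {m : ℕ} (L : Relation m) (I : Implication m) : Prop :=
  I.premise ⊆ L → I.conclusion ⊆ L

/-- `I` is a Gaussian conditional independence implication. -/
def IsCIImplication {m : ℕ} (I : Implication m) : Prop :=
  Disjoint I.premise I.conclusion ∧ Vpd I.premise = Vpd (I.premise ∪ I.conclusion)

/-- The couple `c` can be deduced from the couples in `K` by finitely many applications of the
implications in `A`. -/
inductive Deducible {m : ℕ} (A : Set (Implication m)) (K : Relation m) : Couple m → Prop
  | hyp (c : Couple m) (hc : c ∈ K) : Deducible A K c
  | step (I : Implication m) (hI : I ∈ A) (hp : ∀ d ∈ I.premise, Deducible A K d)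
      (c : Couple m) (hc : c ∈ I.conclusion) : Deducible A K c

/-! ### Duality and relabelling -/

/-- The dual `ij|C'` of `ij|C`, where `C'` is the complement of `ijC`. -/
def Couple.dual {m : ℕ} (c : Couple m) : Couple m :=
  ⟨(c.1.1, (c.1.1 ∪ c.1.2)ᶜ), c.2.1,
    disjoint_compl_right.mono_left Finset.subset_union_left⟩

/-- The couple obtained by applying the permutation `π` to all indices. -/
def Couple.relabel {m : ℕ} (π : Equiv.Perm (Fin m)) (c : Couple m) : Couple m :=
  ⟨(c.1.1.map π.toEmbedding, c.1.2.map π.toEmbedding), by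
    rw [Finset.card_map]; exact c.2.1, (Finset.disjoint_map _).2 c.2.2⟩

/-- The dual of an implication: premise and conclusion are replaced by their dual relations. -/
def Implication.dual {m : ℕ} (I : Implication m) : Implication m :=
  ⟨Couple.dual '' I.premise, Couple.dual '' I.conclusion⟩

/-- The implication obtained by applying the permutation `π` to all indices. -/
def Implication.relabel {m : ℕ} (π : Equiv.Perm (Fin m)) (I : Implication m) : Implication m :=
  ⟨Couple.relabel π '' I.premise, Couple.relabel π '' I.conclusion⟩

/-! ### The axioms -/

/-- The semigaussoid implications, for distinct `i, j, k` and `C` avoiding them. -/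
inductive SemigaussoidAxiom {m : ℕ} : Implication m → Prop
  | weakUnion (i j k : Fin m) (C : Finset (Fin m)) (hij : i ≠ j) (hik : i ≠ k) (hjk : j ≠ k)
      (hi : i ∉ C) (hj : j ∉ C) (hk : k ∉ C) :
      SemigaussoidAxiom
        ⟨{couple i j C, couple i k C}, {couple i j (insert k C), couple i k (insert j C)}⟩
  | contraction (i j k : Fin m) (C : Finset (Fin m)) (hij : i ≠ j) (hik : i ≠ k) (hjk : j ≠ k)
      (hi : i ∉ C) (hj : j ∉ C) (hk : k ∉ C) :
      SemigaussoidAxiom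
        ⟨{couple i j C, couple i k (insert j C)}, {couple i k C, couple i j (insert k C)}⟩
  | intersection (i j k : Fin m) (C : Finset (Fin m)) (hij : i ≠ j) (hik : i ≠ k) (hjk : j ≠ k)
      (hi : i ∉ C) (hj : j ∉ C) (hk : k ∉ C) :
      SemigaussoidAxiom
        ⟨{couple i j (insert k C), couple i k (insert j C)}, {couple i j C, couple i k C}⟩

/-- The five further implications on four distinct indices `i, j, k, l` and `C` avoiding them. -/
inductive FourIndexAxiom {m : ℕ} : Implication m → Prop
  | first (i j k l : Fin m) (C : Finset (Fin m))
      (hij : i ≠ j) (hik : i ≠ k) (hil : i ≠ l) (hjk : j ≠ k) (hjl : j ≠ l) (hkl : k ≠ l)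
      (hi : i ∉ C) (hj : j ∉ C) (hk : k ∉ C) (hl : l ∉ C) :
      FourIndexAxiom
        ⟨{couple i j C, couple k l C, couple i k (insert j (insert l C)),
          couple j l (insert i (insert k C))}, {couple i k C}⟩
  | second (i j k l : Fin m) (C : Finset (Fin m))
      (hij : i ≠ j) (hik : i ≠ k) (hil : i ≠ l) (hjk : j ≠ k) (hjl : j ≠ l) (hkl : k ≠ l)
      (hi : i ∉ C) (hj : j ∉ C) (hk : k ∉ C) (hl : l ∉ C) :
      FourIndexAxiom
        ⟨{couple i j C, couple k l (insert i C), couple k l (insert j C),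
          couple i j (insert k (insert l C))}, {couple k l C}⟩
  | third (i j k l : Fin m) (C : Finset (Fin m))
      (hij : i ≠ j) (hik : i ≠ k) (hil : i ≠ l) (hjk : j ≠ k) (hjl : j ≠ l) (hkl : k ≠ l)
      (hi : i ∉ C) (hj : j ∉ C) (hk : k ∉ C) (hl : l ∉ C) :
      FourIndexAxiom
        ⟨{couple i j C, couple j l (insert k C), couple k l (insert i C),
          couple i k (insert j (insert l C))}, {couple i k C}⟩
  | fourth (i j k l : Fin m) (C : Finset (Fin m))
      (hij : i ≠ j) (hik : i ≠ k) (hil : i ≠ l) (hjk : j ≠ k) (hjl : j ≠ l) (hkl : k ≠ l)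
      (hi : i ∉ C) (hj : j ∉ C) (hk : k ∉ C) (hl : l ∉ C) :
      FourIndexAxiom
        ⟨{couple i j (insert k C), couple i k (insert l C), couple i l (insert j C)},
          {couple i j C}⟩
  | fifth (i j k l : Fin m) (C : Finset (Fin m))
      (hij : i ≠ j) (hik : i ≠ k) (hil : i ≠ l) (hjk : j ≠ k) (hjl : j ≠ l) (hkl : k ≠ l)
      (hi : i ∉ C) (hj : j ∉ C) (hk : k ∉ C) (hl : l ∉ C) :
      FourIndexAxiom
        ⟨{couple i j (insert k C), couple j k (insert l C), couple k l (insert i C),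
          couple i l (insert j C)}, {couple i j C}⟩

/-- The 13 implications specific to four variables, written with the indices `1, 2, 3, 4`.
Numerals in `Fin 4` are read modulo 4, so these are the four distinct elements of `Fin 4`
(with `4` denoting its element `0`). -/
def newImplications : List (Implication 4) := [
  ⟨{couple 2 3 {4}, couple 2 3 {1, 4}, couple 2 4 {1}, couple 3 4 {1}},
    {couple 2 3 ∅, couple 2 3 {1}, couple 2 4 {1, 3}, couple 3 4 {1, 2}}⟩,
  ⟨{couple 2 3 ∅, couple 2 3 {1}, couple 2 4 {1}, couple 3 4 {1}},
    {couple 2 3 {4}, couple 2 3 {1, 4}, couple 2 4 {1, 3}, couple 3 4 {1, 2}}⟩,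
  ⟨{couple 1 4 {2}, couple 1 4 {3}, couple 1 4 {2, 3}, couple 2 3 {1, 4}},
    {couple 1 4 ∅}⟩,
  ⟨{couple 1 4 ∅, couple 1 4 {2}, couple 1 4 {2, 3}, couple 2 3 {1, 4}},
    {couple 1 4 {3}}⟩,
  ⟨{couple 1 4 ∅, couple 1 4 {2}, couple 1 4 {3}, couple 2 3 {1, 4}},
    {couple 1 4 {2, 3}}⟩,
  ⟨{couple 1 4 ∅, couple 1 4 {2, 3}, couple 2 3 {1}, couple 2 3 {1, 4}},
    {couple 1 4 {2}, couple 1 4 {3}}⟩,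
  ⟨{couple 1 4 {2}, couple 1 4 {3}, couple 2 3 {1}, couple 2 3 {1, 4}},
    {couple 1 4 ∅, couple 1 4 {2, 3}}⟩,
  ⟨{couple 1 2 ∅, couple 1 4 {3}, couple 1 4 {2, 3}, couple 2 3 {1, 4}},
    {couple 1 2 {3}, couple 1 2 {4}, couple 1 2 {3, 4}, couple 2 3 {4}}⟩,
  ⟨{couple 1 2 ∅, couple 1 4 {3}, couple 2 3 {4}, couple 2 3 {1, 4}},
    {couple 1 2 {3}, couple 1 2 {4}, couple 1 2 {3, 4}, couple 1 4 {2, 3}}⟩,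
  ⟨{couple 1 2 {3}, couple 1 4 {2}, couple 2 3 {4}, couple 2 3 {1, 4}},
    {couple 1 2 ∅, couple 1 2 {4}, couple 1 2 {3, 4}, couple 1 4 ∅}⟩,
  ⟨{couple 1 2 {3}, couple 1 4 ∅, couple 1 4 {2}, couple 2 3 {1, 4}},
    {couple 1 2 ∅, couple 1 2 {4}, couple 1 2 {3, 4}, couple 2 3 {4}}⟩,
  ⟨{couple 1 4 {2}, couple 2 3 {1}, couple 2 3 {4}, couple 2 3 {1, 4}},
    {couple 2 3 ∅}⟩,
  ⟨{couple 1 4 {2}, couple 2 3 ∅, couple 2 3 {1}, couple 2 3 {1, 4}},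
    {couple 2 3 {4}}⟩]

/-- The axiom system on four variables: the semigaussoid implications, the five four-index
implications, and all relabellings of the 13 implications and of their duals. -/
inductive FourVariableAxiom : Implication 4 → Prop
  | semigaussoid (I : Implication 4) (hI : SemigaussoidAxiom I) : FourVariableAxiom I
  | fourIndex (I : Implication 4) (hI : FourIndexAxiom I) : FourVariableAxiom I
  | new (π : Equiv.Perm (Fin 4)) (I : Implication 4) (hI : I ∈ newImplications) :
      FourVariableAxiom (I.relabel π)
  | newDual (π : Equiv.Perm (Fin 4)) (I : Implication 4) (hI : I ∈ newImplications) :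
      FourVariableAxiom (I.relabel π).dual

end GaussianCI

/-!
Conditioning on `C` and rescaling to unit diagonal turns the minors `det (S_{iC,jC})` of a positive
definite matrix into entries and small minors of a correlation matrix. On at most four indices this
makes the validity of each axiom an algebraic fact about a correlation matrix with positive
principal minors.

Conversely, a couple `c` outside a relation `L` closed under the axioms is separated from `L` by a
positive definite matrix at which all of `L` holds and `c` does not. Relabelling and inversion (the
latter realizing duality) act on the sets of vanishing couples, and 16 integer matrices are enough
up to these symmetries. That they separate every such `c` from every such `L` is decided by a
backtracking search over the couples in `L` and not in `L`, for one `c` from each orbit of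
relabelling. Completeness of closed relations follows, and deducibility does too, because the
couples deducible from a relation form a closed relation.
-/

namespace GaussianCI

open Matrix

/-! ### Minors and elimination -/

section Minors

variable {m : ℕ}

theorem det_submatrix_eq_zero_iff {K n o : Type*} [Field K] [Fintype n] [Fintype o] [DecidableEq o]
    (S : Matrix n n K) (f : o → n) {g : o → n} (hg : Function.Injective g) :
    (S.submatrix f g).det = 0 ↔
      ∃ v : n → K, v ≠ 0 ∧ (∀ r ∉ Set.range g, v r = 0) ∧ ∀ a, (S *ᵥ v) (f a) = 0 := by
  have mulVec_comp : ∀ v : n → K, (∀ r ∉ Set.range g, v r = 0) →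
      ∀ a, (S.submatrix f g *ᵥ (v ∘ g)) a = (S *ᵥ v) (f a) := fun v hv a =>
    Fintype.sum_of_injective g hg _ _ (fun r hr => by simp [hv r hr]) fun _ => rfl
  rw [← Matrix.exists_mulVec_eq_zero_iff]
  constructor
  · rintro ⟨u, hu, h⟩
    have hext : Function.extend g u 0 ∘ g = u := Function.extend_comp hg u 0
    have hsupp : ∀ r ∉ Set.range g, Function.extend g u 0 r = 0 := fun r hr =>
      Function.extend_apply' _ _ _ hr
    refine ⟨Function.extend g u 0, fun h0 => hu ?_, hsupp, fun a => ?_⟩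
    · rw [← hext, h0]; rfl
    · rw [← mulVec_comp _ hsupp, hext, h, Pi.zero_apply]
  · rintro ⟨v, hv, hsupp, h⟩
    refine ⟨v ∘ g, fun h0 => hv (funext fun r => ?_), funext fun a => ?_⟩
    · by_cases hr : r ∈ Set.range g
      · obtain ⟨a, rfl⟩ := hr
        exact congrFun h0 a
      · exact hsupp r hr
    · rw [mulVec_comp v hsupp, h, Pi.zero_apply]

theorem minor_eq_zero_iff (S : Matrix (Fin m) (Fin m) ℝ) {i j : Fin m} {C : Finset (Fin m)}
    (hj : j ∉ C) :
    minor S i j C = 0 ↔ ∃ v : Fin m → ℝ, v ≠ 0 ∧ (∀ r ∉ insert j C, v r = 0) ∧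
      ∀ r ∈ insert i C, (S *ᵥ v) r = 0 := by
  have hinj : Function.Injective fun o : Option C => o.elim j (fun c => (c : Fin m)) := by
    refine Option.injective_iff.2 ⟨Subtype.val_injective, ?_⟩
    rintro ⟨⟨c, hc⟩, h⟩
    exact hj ((show c = j from h) ▸ hc)
  have hrange : ∀ r, r ∈ Set.range (fun o : Option C => o.elim j (fun c => (c : Fin m))) ↔
      r ∈ insert j C := by
    simp [Option.exists, eq_comm]
  rw [minor, det_submatrix_eq_zero_iff S _ hinj]
  simp only [hrange, Option.forall, Subtype.forall, Option.elim_none, Option.elim_some,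
    Finset.forall_mem_insert]

theorem minor_transpose (S : Matrix (Fin m) (Fin m) ℝ) (i j : Fin m) (C : Finset (Fin m)) :
    minor Sᵀ i j C = minor S j i C := by
  unfold minor
  rw [← Matrix.det_transpose]; rfl

theorem minor_map (S : Matrix (Fin m) (Fin m) ℝ) (π : Equiv.Perm (Fin m)) (i j : Fin m)
    (C : Finset (Fin m)) :
    minor S (π i) (π j) (C.map π.toEmbedding) = minor (S.submatrix π π) i j C := by
  have hC : ∀ x, x ∈ C ↔ π x ∈ C.map π.toEmbedding := fun x => by simp
  let e : Option C ≃ Option (C.map π.toEmbedding) := (π.subtypeEquiv hC).optionCongr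
  unfold minor
  rw [← Matrix.det_submatrix_equiv_self e]
  congr 1
  ext a b
  rcases a with _ | a <;> rcases b with _ | b <;> rfl

theorem minor_rescale (d : Fin m → ℝ) (S : Matrix (Fin m) (Fin m) ℝ) (i j : Fin m)
    (C : Finset (Fin m)) :
    minor (Matrix.of fun i j => d i * S i j * d j) i j C =
      (d i * ∏ c ∈ C, d c) * ((d j * ∏ c ∈ C, d c) * minor S i j C) := by
  unfold minor
  have hprod : ∀ k, ∏ o : Option C, d (o.elim k fun c => (c : Fin m)) = d k * ∏ c ∈ C, d c :=
    fun k => by rw [Fintype.prod_option]; exact congrArg _ (Finset.prod_coe_sort C d)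
  rw [← hprod i, ← hprod j, ← Matrix.det_mul_row, ← Matrix.det_mul_column]
  congr 1
  ext a b
  simp only [Matrix.submatrix_apply, Matrix.of_apply]
  ring

theorem minor_eq_det_of_bijOn {n : ℕ} (S : Matrix (Fin m) (Fin m) ℝ) (i j : Fin m)
    {l : Fin n → Fin m} {C : Finset (Fin m)} (hl : Set.BijOn l Set.univ C) :
    minor S i j C = (S.submatrix (Fin.cons i l : Fin (n + 1) → Fin m)
      (Fin.cons j l : Fin (n + 1) → Fin m)).det := by
  let e : Fin (n + 1) ≃ Option C :=
    (finSuccEquiv n).trans ((Equiv.Set.univ _).symm.trans hl.equiv).optionCongr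
  rw [minor, ← Matrix.det_submatrix_equiv_self e]
  congr 1
  ext a b
  refine Fin.cases ?_ (fun a => ?_) a <;> refine Fin.cases ?_ (fun b => ?_) b <;> rfl

theorem minor_empty (S : Matrix (Fin m) (Fin m) ℝ) (i j : Fin m) : minor S i j ∅ = S i j := by
  rw [minor_eq_det_of_bijOn S i j (l := Fin.elim0)
    ⟨fun a => a.elim0, fun a => a.elim0, fun a ha => (Finset.notMem_empty a ha).elim⟩,
    Matrix.det_fin_one]
  rfl

theorem minor_singleton (S : Matrix (Fin m) (Fin m) ℝ) (i j k : Fin m) :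
    minor S i j {k} = S i j * S k k - S i k * S k j := by
  rw [minor_eq_det_of_bijOn S i j (l := ![k])
    (by simp [Set.BijOn, Set.SurjOn, Set.MapsTo, Function.injective_of_subsingleton]),
    Matrix.det_fin_two]
  rfl

theorem minor_pair (S : Matrix (Fin m) (Fin m) ℝ) (i j : Fin m) {k l : Fin m} (h : k ≠ l) :
    minor S i j {k, l} = S i j * (S k k * S l l - S k l * S l k)
      - S i k * (S k j * S l l - S k l * S l j) + S i l * (S k j * S l k - S k k * S l j) := by
  have hl : Set.BijOn ![k, l] Set.univ (({k, l} : Finset (Fin m)) : Set (Fin m)) := by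
    simp [Set.BijOn, Set.SurjOn, Set.MapsTo, Set.InjOn, Set.subset_def, Fin.forall_fin_two, h,
      h.symm]
  rw [minor_eq_det_of_bijOn S i j hl, Matrix.det_fin_three]
  change S i j * S k k * S l l - S i j * S k l * S l k - S i k * S k j * S l l
    + S i k * S k l * S l j + S i l * S k j * S l k - S i l * S k k * S l j = _
  ring

end Minors

section Elimination

variable {m : ℕ} {R : Type*} [CommRing R]

/-- One step of fraction-free Gaussian elimination with pivot `k`: the Schur complement of the
pivot, multiplied by `S k k`, as a direct sum with the `1 × 1` identity matrix at `k`. -/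
def eliminate (k : Fin m) (S : Matrix (Fin m) (Fin m) R) : Matrix (Fin m) (Fin m) R :=
  Matrix.of fun i j => S k k * S i j - S i k * S k j + if i = k ∧ j = k then 1 else 0

theorem eliminate_transpose (k : Fin m) (S : Matrix (Fin m) (Fin m) R) :
    (eliminate k S)ᵀ = eliminate k Sᵀ := by
  ext i j
  simp only [eliminate, Matrix.transpose_apply, Matrix.of_apply, and_comm]
  ring

theorem updateRow_one_eq_one_add_vecMulVec (k : Fin m) (u : Fin m → R) :
    Matrix.updateRow 1 k u = 1 + Matrix.vecMulVec (Pi.single k 1) (u - Pi.single k 1) := by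
  ext i j
  by_cases hi : i = k <;>
    simp [hi, Matrix.vecMulVec_apply, Matrix.one_apply, Pi.single_apply, eq_comm]

theorem eliminate_mul_updateRow_one (k : Fin m) (S : Matrix (Fin m) (Fin m) R) :
    eliminate k S * Matrix.updateRow 1 k (S k) =
      Matrix.updateRow (S k k • S - Matrix.vecMulVec (S.col k) (S k)) k (S k) := by
  have hpivot : eliminate k S *ᵥ Pi.single k 1 = Pi.single k 1 := by
    ext i
    simp [eliminate, Pi.single_apply, mul_comm]
  rw [updateRow_one_eq_one_add_vecMulVec, Matrix.mul_add, Matrix.mul_vecMulVec, hpivot,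
    Matrix.mul_one]
  ext i j
  by_cases hi : i = k <;> by_cases hj : j = k <;> simp [hi, hj, eliminate, Matrix.vecMulVec_apply]

theorem smul_eq_transpose_mul_eliminate_mul (k : Fin m) {S : Matrix (Fin m) (Fin m) R}
    (hS : S.IsSymm) :
    S k k • S = (Matrix.updateRow 1 k (S k))ᵀ * eliminate k S * Matrix.updateRow 1 k (S k) := by
  rw [Matrix.mul_assoc, eliminate_mul_updateRow_one, updateRow_one_eq_one_add_vecMulVec,
    Matrix.transpose_add, Matrix.transpose_one, Matrix.transpose_vecMulVec, Matrix.add_mul,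
    Matrix.one_mul, Matrix.vecMulVec_mul]
  ext i j
  have hki : S i k = S k i := congrFun (congrFun hS k) i
  by_cases hi : i = k
  · simp only [hi, Matrix.single_vecMul, one_smul, Matrix.smul_apply, Matrix.add_apply,
      Matrix.updateRow_self, Matrix.vecMulVec_apply, Matrix.row_apply, Pi.sub_apply,
      Pi.single_eq_same, smul_eq_mul]
    ring
  · simp [hi, hki, Matrix.vecMulVec_apply]

theorem isUnit_updateRow_one {k : Fin m} {u : Fin m → R} (hu : IsUnit (u k)) :
    IsUnit (Matrix.updateRow 1 k u) := by
  rwa [Matrix.isUnit_iff_isUnit_det, ← Matrix.cramer_transpose_apply, Matrix.transpose_one,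
    Matrix.cramer_one, Module.End.one_apply]

theorem eliminate_mulVec_apply_of_ne (S : Matrix (Fin m) (Fin m) R) {k r : Fin m} (hr : r ≠ k)
    (v : Fin m → R) : (eliminate k S *ᵥ Matrix.updateRow 1 k (S k) *ᵥ v) r =
      S k k * (S *ᵥ v) r - (S *ᵥ v) k * S r k := by
  rw [Matrix.mulVec_mulVec, eliminate_mul_updateRow_one, Matrix.updateRow_mulVec,
    Matrix.sub_mulVec, Matrix.smul_mulVec, Matrix.vecMulVec_mulVec]
  simp [hr, Matrix.mulVec]

theorem posDef_eliminate_iff {k : Fin m} {S : Matrix (Fin m) (Fin m) ℝ} (hS : S.IsSymm)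
    (hk : 0 < S k k) : (eliminate k S).PosDef ↔ S.PosDef := by
  rw [← (isUnit_updateRow_one hk.ne'.isUnit).posDef_star_left_conjugate_iff,
    Matrix.star_eq_conjTranspose, Matrix.conjTranspose_eq_transpose_of_trivial,
    ← smul_eq_transpose_mul_eliminate_mul k hS]
  refine ⟨fun h => ?_, fun h => h.smul hk⟩
  have := h.smul (inv_pos.2 hk)
  rwa [smul_smul, inv_mul_cancel₀ hk.ne', one_smul] at this

theorem minor_insert_eq_zero_iff {S : Matrix (Fin m) (Fin m) ℝ} {i j k : Fin m}
    {C : Finset (Fin m)} (hk : S k k ≠ 0) (hik : i ≠ k) (hjk : j ≠ k) (hj : j ∉ C) (hkC : k ∉ C) :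
    minor S i j (insert k C) = 0 ↔ minor (eliminate k S) i j C = 0 := by
  rw [minor_eq_zero_iff S (by simp [hj, hjk]), minor_eq_zero_iff _ hj]
  have hQ := isUnit_updateRow_one (u := S k) hk.isUnit
  refine Iff.trans (exists_congr fun v => ?_)
    (Matrix.mulVec_surjective_iff_isUnit.2 hQ).exists.symm
  have hQv : Matrix.updateRow 1 k (S k) *ᵥ v = Function.update v k ((S *ᵥ v) k) := by
    rw [Matrix.updateRow_mulVec, Matrix.one_mulVec]
    rfl
  have hne : v ≠ 0 ↔ Matrix.updateRow 1 k (S k) *ᵥ v ≠ 0 := by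
    rw [← (Matrix.mulVec_injective_iff_isUnit.2 hQ).ne_iff, Matrix.mulVec_zero]
  rw [← hne, hQv]
  refine and_congr_right fun _ => ⟨fun ⟨hsupp, hker⟩ => ?_, fun ⟨hsupp, hker⟩ => ?_⟩
  · have hvk : (S *ᵥ v) k = 0 := hker k (by simp)
    refine ⟨fun r hr => ?_, fun r hr => ?_⟩
    · by_cases hrk : r = k
      · simp [hrk, hvk]
      · rw [Function.update_of_ne hrk]
        exact hsupp r (by grind)
    · have hrk : r ≠ k := by grind
      rw [← hQv, eliminate_mulVec_apply_of_ne S hrk, hvk, hker r (by grind)]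
      ring
  · have hvk : (S *ᵥ v) k = 0 := by simpa using hsupp k (by grind)
    refine ⟨fun r hr => ?_, fun r hr => ?_⟩
    · have := hsupp r (by grind)
      rwa [Function.update_of_ne (by grind)] at this
    · by_cases hrk : r = k
      · rw [hrk, hvk]
      · have := hker r (by grind)
        rw [← hQv, eliminate_mulVec_apply_of_ne S hrk, hvk] at this
        simpa [hk] using this

end Elimination

section Couples

variable {m : ℕ} {S : Matrix (Fin m) (Fin m) ℝ}

theorem isSymm_of_posDef (hS : S.PosDef) : S.IsSymm := by
  rw [Matrix.IsSymm, ← Matrix.conjTranspose_eq_transpose_of_trivial]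
  exact hS.isHermitian

theorem pair_eq_pair_iff {α : Type*} [DecidableEq α] {a b c d : α} :
    ({a, b} : Finset α) = {c, d} ↔ a = c ∧ b = d ∨ a = d ∧ b = c := by
  rw [← Finset.coe_inj, Finset.coe_pair, Finset.coe_pair, Set.pair_eq_pair_iff]

theorem couple_holdsAt_iff (hS : S.IsSymm) {i j : Fin m} {C : Finset (Fin m)} (hij : i ≠ j)
    (hi : i ∉ C) (hj : j ∉ C) : (couple i j C hij hi hj).HoldsAt S ↔ minor S i j C = 0 := by
  refine ⟨fun h => h i j rfl, fun h a b hab => ?_⟩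
  rcases pair_eq_pair_iff.1 (show ({i, j} : Finset (Fin m)) = {a, b} from hab) with
    ⟨rfl, rfl⟩ | ⟨rfl, rfl⟩
  · exact h
  · rw [← hS.eq, minor_transpose]; exact h

theorem Couple.eq_couple (c : Couple m) : ∃ i j C hij hi hj, c = couple i j C hij hi hj := by
  obtain ⟨⟨p, C⟩, hp, hpC⟩ := c
  obtain ⟨i, j, hij, rfl⟩ := Finset.card_eq_two.1 hp
  have h := Finset.disjoint_left.1 hpC
  exact ⟨i, j, C, hij, h (by simp), h (by simp), rfl⟩

theorem Couple.relabel_couple (π : Equiv.Perm (Fin m)) {i j : Fin m} {C : Finset (Fin m)}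
    (hij : i ≠ j) (hi : i ∉ C) (hj : j ∉ C) : (couple i j C hij hi hj).relabel π =
      couple (π i) (π j) (C.map π.toEmbedding) (by simpa) (by simpa) (by simpa) := by
  refine Subtype.ext (Prod.ext ?_ rfl)
  simp [Couple.relabel, couple]

theorem Couple.relabel_holdsAt_iff (π : Equiv.Perm (Fin m)) (c : Couple m)
    (S : Matrix (Fin m) (Fin m) ℝ) : (c.relabel π).HoldsAt S ↔ c.HoldsAt (S.submatrix π π) := by
  have hpair (i j : Fin m) : (c.relabel π).1.1 = {π i, π j} ↔ c.1.1 = {i, j} := by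
    rw [show ({π i, π j} : Finset (Fin m)) = ({i, j} : Finset (Fin m)).map π.toEmbedding by simp]
    exact Finset.map_inj
  unfold Couple.HoldsAt
  rw [π.surjective.forall]
  refine forall_congr' fun i => ?_
  rw [π.surjective.forall]
  refine forall_congr' fun j => ?_
  rw [hpair, ← minor_map]
  rfl

theorem Couple.dual_dual (c : Couple m) : c.dual.dual = c := by
  refine Subtype.ext (Prod.ext rfl ?_)
  ext x
  have : x ∈ c.1.1 → x ∉ c.1.2 := fun h => Finset.disjoint_left.1 c.2.2 h
  simp only [Couple.dual, Finset.mem_compl, Finset.mem_union]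
  tauto

theorem Couple.HoldsAt.dual_inv {c : Couple m} (hS : S.PosDef) (h : c.HoldsAt S) :
    c.dual.HoldsAt S⁻¹ := by
  obtain ⟨i, j, C, hij, hi, hj, rfl⟩ := c.eq_couple
  have hdual : (couple i j C hij hi hj).dual =
      couple i j (({i, j} ∪ C)ᶜ) hij (by simp) (by simp) := rfl
  obtain ⟨v, hv, hsupp, hker⟩ :=
    (minor_eq_zero_iff S hj).1 ((couple_holdsAt_iff (isSymm_of_posDef hS) hij hi hj).1 h)
  have hinv : S⁻¹ *ᵥ (S *ᵥ v) = v := by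
    rw [Matrix.mulVec_mulVec, Matrix.nonsing_inv_mul _ hS.det_pos.ne'.isUnit, Matrix.one_mulVec]
  rw [hdual, couple_holdsAt_iff (isSymm_of_posDef hS.inv), minor_eq_zero_iff _ (by simp)]
  refine ⟨S *ᵥ v, fun h0 => hv ?_, fun r hr => hker r ?_, fun r hr => ?_⟩
  · rw [← hinv, h0, Matrix.mulVec_zero]
  · simp only [Finset.mem_insert, Finset.mem_compl, Finset.mem_union, Finset.mem_singleton]
      at hr ⊢
    tauto
  · simp only [Finset.mem_insert, Finset.mem_compl, Finset.mem_union, Finset.mem_singleton] at hr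
    rw [hinv]
    refine hsupp r ?_
    rw [Finset.mem_insert, not_or]
    rcases hr with rfl | hr
    · exact ⟨hij, hi⟩
    · tauto

theorem Couple.dual_holdsAt_iff (c : Couple m) (hS : S.PosDef) :
    c.dual.HoldsAt S ↔ c.HoldsAt S⁻¹ := by
  constructor
  · intro h
    simpa only [Couple.dual_dual] using h.dual_inv hS
  · intro h
    have := h.dual_inv hS.inv
    rwa [Matrix.nonsing_inv_nonsing_inv _ hS.det_pos.ne'.isUnit] at this

end Couples

section PartialCorrelation

variable {m : ℕ} {S R : Matrix (Fin m) (Fin m) ℝ}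

theorem det_symm_unitDiagonal_fin_four {K : Type*} [CommRing K] (a b c d e f : K) :
    !![1, a, b, c; a, 1, d, e; b, d, 1, f; c, e, f, 1].det =
      1 - a ^ 2 - b ^ 2 - c ^ 2 - d ^ 2 - e ^ 2 - f ^ 2
        + 2 * a * b * d + 2 * a * c * e + 2 * b * c * f + 2 * d * e * f
        + a ^ 2 * f ^ 2 + b ^ 2 * e ^ 2 + c ^ 2 * d ^ 2
        - 2 * a * b * e * f - 2 * a * c * d * f - 2 * b * c * d * e := by
  rw [Matrix.det_succ_row_zero, Fin.sum_univ_four]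
  simp [Matrix.det_fin_three, Fin.succAbove, Fin.lt_def]
  ring

theorem posDef_rescale (hS : S.PosDef) {d : Fin m → ℝ} (hd : ∀ i, d i ≠ 0) :
    (Matrix.of fun i j => d i * S i j * d j).PosDef := by
  have heq : (Matrix.of fun i j => d i * S i j * d j) =
      (Matrix.diagonal d)ᴴ * S * Matrix.diagonal d := by
    ext i j
    simp
  rw [heq]
  refine hS.conjTranspose_mul_mul_same (Matrix.mulVec_injective_of_isUnit ?_)
  rw [Matrix.isUnit_iff_isUnit_det, Matrix.det_diagonal]
  exact (Finset.prod_ne_zero_iff.2 fun i _ => hd i).isUnit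

/-- `R` is a partial correlation matrix of `S` given `C`: a positive definite matrix with unit
diagonal whose minors outside `C` vanish when those of `S` conditioned on `C` do. The rows and
columns of `R` in `C` play no role. -/
structure IsPartialCorrelation (S : Matrix (Fin m) (Fin m) ℝ) (C : Finset (Fin m))
    (R : Matrix (Fin m) (Fin m) ℝ) : Prop where
  posDef : R.PosDef
  diag : ∀ i, R i i = 1
  minor_eq_zero_iff : ∀ {i j : Fin m} {D : Finset (Fin m)}, i ∉ C → j ∉ C → j ∉ D →
    Disjoint C D → (minor S i j (C ∪ D) = 0 ↔ minor R i j D = 0)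

theorem exists_isPartialCorrelation (hS : S.PosDef) (C : Finset (Fin m)) :
    ∃ R, IsPartialCorrelation S C R := by
  induction C using Finset.induction_on generalizing S with
  | empty =>
    have hsqrt (i : Fin m) : √(S i i) ≠ 0 := (Real.sqrt_pos.2 hS.diag_pos).ne'
    have hd (i : Fin m) : (√(S i i))⁻¹ ≠ 0 := inv_ne_zero (hsqrt i)
    refine ⟨_, posDef_rescale hS hd, fun i => ?_, fun {i j D} _ _ _ _ => ?_⟩
    · rw [Matrix.of_apply, ← div_eq_mul_inv, inv_mul_eq_div, Real.div_sqrt, div_self (hsqrt i)]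
    · have hprod := (Finset.prod_ne_zero_iff (s := D)).2 fun c _ => hd c
      rw [Finset.empty_union, minor_rescale, mul_eq_zero_iff_left (mul_ne_zero (hd i) hprod),
        mul_eq_zero_iff_left (mul_ne_zero (hd j) hprod)]
  | insert k C hk ih =>
    obtain ⟨R, hR⟩ := ih ((posDef_eliminate_iff (isSymm_of_posDef hS) hS.diag_pos).2 hS)
    refine ⟨R, hR.posDef, hR.diag, fun {i j D} hi hj hjD hD => ?_⟩
    rw [Finset.mem_insert, not_or] at hi hj
    rw [Finset.disjoint_insert_left] at hD
    rw [Finset.insert_union, minor_insert_eq_zero_iff hS.diag_pos.ne' hi.1 hj.1 (by simp [hj, hjD])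
      (by simp [hk, hD]), hR.minor_eq_zero_iff hi.2 hj.2 hjD hD.2]

namespace IsPartialCorrelation

variable {C : Finset (Fin m)}

theorem symm (hR : IsPartialCorrelation S C R) (i j : Fin m) : R i j = R j i :=
  (isSymm_of_posDef hR.posDef).apply j i

theorem couple_holdsAt_iff (hR : IsPartialCorrelation S C R) (hS : S.PosDef) {i j : Fin m}
    (hij : i ≠ j) (hi : i ∉ C) (hj : j ∉ C) :
    (couple i j C hij hi hj).HoldsAt S ↔ R i j = 0 := by
  have h := hR.minor_eq_zero_iff hi hj (Finset.notMem_empty j) (Finset.disjoint_empty_right C)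
  rwa [Finset.union_empty, minor_empty,
    ← GaussianCI.couple_holdsAt_iff (isSymm_of_posDef hS) hij hi hj] at h

theorem couple_insert_holdsAt_iff (hR : IsPartialCorrelation S C R) (hS : S.PosDef)
    {i j k : Fin m} (hk : k ∉ C) (hij : i ≠ j) (hi : i ∉ insert k C) (hj : j ∉ insert k C) :
    (couple i j (insert k C) hij hi hj).HoldsAt S ↔ R i j - R i k * R j k = 0 := by
  simp only [Finset.mem_insert, not_or] at hi hj
  have h := hR.minor_eq_zero_iff hi.2 hj.2 (D := {k}) (by simp [hj]) (by simpa)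
  rw [GaussianCI.couple_holdsAt_iff (isSymm_of_posDef hS), Finset.insert_eq, Finset.union_comm, h,
    minor_singleton, hR.diag, hR.symm k j, mul_one]

theorem couple_insert_insert_holdsAt_iff (hR : IsPartialCorrelation S C R) (hS : S.PosDef)
    {i j k l : Fin m} (hkl : k ≠ l) (hk : k ∉ C) (hl : l ∉ C) (hij : i ≠ j)
    (hi : i ∉ insert k (insert l C)) (hj : j ∉ insert k (insert l C)) :
    (couple i j (insert k (insert l C)) hij hi hj).HoldsAt S ↔
      R i j * (1 - R k l ^ 2) - R i k * (R j k - R k l * R j l)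
        + R i l * (R j k * R k l - R j l) = 0 := by
  simp only [Finset.mem_insert, not_or] at hi hj
  have h := hR.minor_eq_zero_iff hi.2.2 hj.2.2 (D := {k, l}) (by simp [hj]) (by simp [hk, hl])
  have hunion : insert k (insert l C) = C ∪ {k, l} := by grind
  rw [GaussianCI.couple_holdsAt_iff (isSymm_of_posDef hS), hunion, h, minor_pair _ _ _ hkl,
    hR.diag, hR.diag, hR.symm k j, hR.symm l j, hR.symm l k]
  ring_nf

theorem det_submatrix_pos (hR : IsPartialCorrelation S C R) {n : ℕ} {e : Fin n → Fin m}
    (he : Function.Injective e) : 0 < (R.submatrix e e).det :=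
  (hR.posDef.submatrix he).det_pos

theorem pos_two (hR : IsPartialCorrelation S C R) {i j : Fin m} (hij : i ≠ j) :
    0 < 1 - R i j ^ 2 := by
  have := hR.det_submatrix_pos (e := ![i, j]) (by
    intro a b; fin_cases a <;> fin_cases b <;> simp [hij, hij.symm])
  rw [Matrix.det_fin_two] at this
  simp only [submatrix_apply, Matrix.cons_val, hR.diag, hR.symm j i] at this
  linarith

theorem pos_three (hR : IsPartialCorrelation S C R) {i j k : Fin m} (hij : i ≠ j) (hik : i ≠ k)
    (hjk : j ≠ k) :
    0 < 1 + 2 * R i j * R i k * R j k - R i j ^ 2 - R i k ^ 2 - R j k ^ 2 := by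
  have := hR.det_submatrix_pos (e := ![i, j, k]) (by
    intro a b; fin_cases a <;> fin_cases b <;> simp [hij, hij.symm, hik, hik.symm, hjk, hjk.symm])
  rw [Matrix.det_fin_three] at this
  simp only [submatrix_apply, Matrix.cons_val, hR.diag, hR.symm j i, hR.symm k i, hR.symm k j]
    at this
  linarith

theorem pos_four (hR : IsPartialCorrelation S C R) {i j k l : Fin m} (hij : i ≠ j) (hik : i ≠ k)
    (hil : i ≠ l) (hjk : j ≠ k) (hjl : j ≠ l) (hkl : k ≠ l) :
    0 < 1 - R i j ^ 2 - R i k ^ 2 - R i l ^ 2 - R j k ^ 2 - R j l ^ 2 - R k l ^ 2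
      + 2 * R i j * R i k * R j k + 2 * R i j * R i l * R j l + 2 * R i k * R i l * R k l
      + 2 * R j k * R j l * R k l + R i j ^ 2 * R k l ^ 2 + R i k ^ 2 * R j l ^ 2
      + R i l ^ 2 * R j k ^ 2 - 2 * R i j * R i k * R j l * R k l
      - 2 * R i j * R i l * R j k * R k l - 2 * R i k * R i l * R j k * R j l := by
  have := hR.det_submatrix_pos (e := ![i, j, k, l]) (by
    intro a b
    fin_cases a <;> fin_cases b <;> simp [hij, hij.symm, hik, hik.symm, hjk, hjk.symm, hil,
      hil.symm, hjl, hjl.symm, hkl, hkl.symm])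
  have hsubmatrix : R.submatrix ![i, j, k, l] ![i, j, k, l] =
      !![1, R i j, R i k, R i l; R i j, 1, R j k, R j l; R i k, R j k, 1, R k l;
        R i l, R j l, R k l, 1] := by
    ext a b
    fin_cases a <;> fin_cases b <;> first | exact hR.diag _ | rfl | exact hR.symm _ _
  rw [hsubmatrix, det_symm_unitDiagonal_fin_four] at this
  exact this

end IsPartialCorrelation

end PartialCorrelation

/-! ### Soundness -/

/-- The implication holds at every positive definite matrix. -/
def Sound {m : ℕ} (I : Implication m) : Prop :=
  ∀ S : Matrix (Fin m) (Fin m) ℝ, S.PosDef → (∀ c ∈ I.premise, c.HoldsAt S) →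
    ∀ c ∈ I.conclusion, c.HoldsAt S

theorem Sound.relabel {m : ℕ} {I : Implication m} (h : Sound I) (π : Equiv.Perm (Fin m)) :
    Sound (I.relabel π) := by
  rintro S hS hp _ ⟨c, hc, rfl⟩
  rw [Couple.relabel_holdsAt_iff]
  refine h _ (hS.submatrix π.injective) (fun d hd => ?_) c hc
  rw [← Couple.relabel_holdsAt_iff]
  exact hp _ ⟨d, hd, rfl⟩

theorem Sound.dual {m : ℕ} {I : Implication m} (h : Sound I) : Sound I.dual := by
  rintro S hS hp _ ⟨c, hc, rfl⟩
  rw [Couple.dual_holdsAt_iff _ hS]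
  refine h _ hS.inv (fun d hd => ?_) c hc
  rw [← Couple.dual_holdsAt_iff _ hS]
  exact hp _ ⟨d, hd, rfl⟩

theorem SemigaussoidAxiom.sound {m : ℕ} {I : Implication m} (hI : SemigaussoidAxiom I) :
    Sound I := by
  intro S hS
  rcases hI with ⟨i, j, k, C, hij, hik, hjk, hi, hj, hk⟩ | ⟨i, j, k, C, hij, hik, hjk, hi, hj, hk⟩ |
    ⟨i, j, k, C, hij, hik, hjk, hi, hj, hk⟩
  all_goals
    obtain ⟨R, hR⟩ := exists_isPartialCorrelation hS C
    have hpos := hR.pos_two hjk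
    simp only [Set.mem_insert_iff, Set.mem_singleton_iff, forall_eq_or_imp, forall_eq,
      hR.couple_holdsAt_iff hS, hR.couple_insert_holdsAt_iff hS hj,
      hR.couple_insert_holdsAt_iff hS hk, hR.symm k j]
  · rintro ⟨h1, h2⟩
    simp only [h1, h2, zero_mul, sub_zero, and_self]
  · rintro ⟨h1, h2⟩
    rw [h1, zero_mul, sub_zero] at h2
    simp only [h1, h2, zero_mul, sub_zero, and_self]
  · rintro ⟨h1, h2⟩
    have h3 : R i j * (1 - R j k ^ 2) = 0 := by linear_combination h1 + R j k * h2
    have h4 : R i k * (1 - R j k ^ 2) = 0 := by linear_combination h2 + R j k * h1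
    exact ⟨(mul_eq_zero.1 h3).resolve_right hpos.ne', (mul_eq_zero.1 h4).resolve_right hpos.ne'⟩

section RealAlgebra

variable {a b c d e f : ℝ}

theorem eq_zero_of_two_by_two (hb : 0 < 1 - b ^ 2) (h1 : b * (1 - e ^ 2) + c * (e * d) = 0)
    (h2 : e * (1 - b ^ 2) + b * c * d = 0)
    (hdet : 0 < 1 - b ^ 2 - c ^ 2 - d ^ 2 - e ^ 2 + (b * e - c * d) ^ 2) : b = 0 := by
  by_contra h
  have he : e ^ 2 = b ^ 2 := by linear_combination (-b) * h1 + e * h2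
  have h3 : b * (1 - b ^ 2 - c ^ 2 - d ^ 2 - e ^ 2 + (b * e - c * d) ^ 2)
      = b * (2 * (1 - b ^ 2) - c ^ 2 - d ^ 2) := by
    grind
  have h4 : (c * d) ^ 2 = (1 - b ^ 2) ^ 2 := by grind
  rw [mul_left_cancel₀ h h3] at hdet
  nlinarith [sq_nonneg (c ^ 2 - d ^ 2)]

theorem eq_zero_of_common_product (h1 : f = b * c) (h2 : f = d * e)
    (h3 : b * d + c * e = f * (b * e + c * d)) (hbd : 0 < 1 - b ^ 2 - d ^ 2)
    (hce : 0 < 1 - c ^ 2 - e ^ 2) : f = 0 := by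
  by_contra h
  have hp : 0 < f ^ 2 := by positivity
  have h4 : (b * e + c * d) ^ 2 < 1 := by
    nlinarith [sq_nonneg (b * c - d * e), sq_nonneg (b * c + d * e)]
  have h5 : (b * d + c * e) ^ 2 = f ^ 2 * (b * e + c * d) ^ 2 := by rw [h3]; ring
  have h6 : (b * d) * (c * e) = f ^ 2 := by grind
  nlinarith [sq_nonneg (b * d - c * e)]

theorem eq_zero_of_mul_eq_zero_of_pos (hb : 0 < 1 - b ^ 2) (hc : 0 < 1 - c ^ 2)
    (h : b * (1 - (b * c * d) ^ 2) + c * (d * (b * c * d) - b * c) = 0) : b = 0 := by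
  have h1 : b * ((1 - c ^ 2) + (c * d) ^ 2 * (1 - b ^ 2)) = 0 := by linear_combination h
  have h2 : 0 < (1 - c ^ 2) + (c * d) ^ 2 * (1 - b ^ 2) := by positivity
  exact (mul_eq_zero.1 h1).resolve_right h2.ne'

theorem eq_zero_of_eq_mul_three (hd : 0 < 1 - d ^ 2) (he : 0 < 1 - e ^ 2) (hf : 0 < 1 - f ^ 2)
    (h : a = a * e * f * d) : a = 0 := by
  have h1 : (d * e * f) ^ 2 < 1 := by
    calc (d * e * f) ^ 2 = d ^ 2 * (e ^ 2 * f ^ 2) := by ring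
      _ < 1 := by
        apply mul_lt_one_of_nonneg_of_lt_one_left <;> nlinarith [sq_nonneg e, sq_nonneg f]
  have h2 : a * (1 - d * e * f) = 0 := by linear_combination h
  refine (mul_eq_zero.1 h2).resolve_right fun h3 => ?_
  have h4 : d * e * f = 1 := by linarith
  rw [h4] at h1
  norm_num at h1

theorem eq_zero_of_eq_mul_sq (hb : 0 < 1 - b ^ 2) (he : 0 < 1 - e ^ 2)
    (h : a = b ^ 2 * e ^ 2 * a) : a = 0 := by
  have h1 : b ^ 2 * e ^ 2 < 1 :=
    mul_lt_one_of_nonneg_of_lt_one_left (sq_nonneg b) (by linarith) (by linarith)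
  have h2 : a * (1 - b ^ 2 * e ^ 2) = 0 := by linear_combination h
  exact (mul_eq_zero.1 h2).resolve_right (by linarith)

end RealAlgebra

namespace FourIndexAxiom

variable {m : ℕ} {i j k l : Fin m} {C : Finset (Fin m)}

theorem sound_first (hij : i ≠ j) (hik : i ≠ k) (hil : i ≠ l) (hjk : j ≠ k) (hjl : j ≠ l)
    (hkl : k ≠ l) (hi : i ∉ C) (hj : j ∉ C) (hk : k ∉ C) (hl : l ∉ C) :
    Sound ⟨{couple i j C, couple k l C, couple i k (insert j (insert l C)),
      couple j l (insert i (insert k C))}, {couple i k C}⟩ := by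
  intro S hS
  obtain ⟨R, hR⟩ := exists_isPartialCorrelation hS C
  simp only [Set.mem_insert_iff, Set.mem_singleton_iff, forall_eq_or_imp, forall_eq,
    hR.couple_holdsAt_iff hS, hR.couple_insert_insert_holdsAt_iff hS hjl hj hl,
    hR.couple_insert_insert_holdsAt_iff hS hik hi hk, hR.symm k j, hR.symm j i, hR.symm l i,
    hR.symm l k]
  rintro ⟨h1, h2, h3, h4⟩
  have hdet := hR.pos_four hij hik hil hjk hjl hkl
  rw [h1, h2] at h3 h4 hdet
  refine eq_zero_of_two_by_two (hR.pos_two hik) (c := R i l) (d := R j k) (e := R j l) ?_ ?_ ?_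
  · linear_combination h3
  · linear_combination h4
  · linarith

theorem sound_second (hij : i ≠ j) (hik : i ≠ k) (hil : i ≠ l) (hjk : j ≠ k) (hjl : j ≠ l)
    (hkl : k ≠ l) (hi : i ∉ C) (hj : j ∉ C) (hk : k ∉ C) (hl : l ∉ C) :
    Sound ⟨{couple i j C, couple k l (insert i C), couple k l (insert j C),
      couple i j (insert k (insert l C))}, {couple k l C}⟩ := by
  intro S hS
  obtain ⟨R, hR⟩ := exists_isPartialCorrelation hS C
  simp only [Set.mem_insert_iff, Set.mem_singleton_iff, forall_eq_or_imp, forall_eq,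
    hR.couple_holdsAt_iff hS, hR.couple_insert_holdsAt_iff hS hi,
    hR.couple_insert_holdsAt_iff hS hj, hR.couple_insert_insert_holdsAt_iff hS hkl hk hl,
    hR.symm k i, hR.symm l i, hR.symm k j, hR.symm l j]
  rintro ⟨h1, h2, h3, h4⟩
  have hijk := hR.pos_three hij hik hjk
  have hijl := hR.pos_three hij hil hjl
  rw [h1] at hijk hijl h4
  exact eq_zero_of_common_product (sub_eq_zero.1 h2) (sub_eq_zero.1 h3) (by linarith)
    (by linarith) (by linarith)

theorem sound_third (hij : i ≠ j) (hik : i ≠ k) (hil : i ≠ l) (hjk : j ≠ k) (hjl : j ≠ l)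
    (hkl : k ≠ l) (hi : i ∉ C) (hj : j ∉ C) (hk : k ∉ C) (hl : l ∉ C) :
    Sound ⟨{couple i j C, couple j l (insert k C), couple k l (insert i C),
      couple i k (insert j (insert l C))}, {couple i k C}⟩ := by
  intro S hS
  obtain ⟨R, hR⟩ := exists_isPartialCorrelation hS C
  simp only [Set.mem_insert_iff, Set.mem_singleton_iff, forall_eq_or_imp, forall_eq,
    hR.couple_holdsAt_iff hS, hR.couple_insert_holdsAt_iff hS hi,
    hR.couple_insert_holdsAt_iff hS hk, hR.couple_insert_insert_holdsAt_iff hS hjl hj hl,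
    hR.symm k i, hR.symm l i, hR.symm k j, hR.symm l k, sub_eq_zero (a := R j l),
    sub_eq_zero (a := R k l)]
  rintro ⟨h1, h2, h3, h4⟩
  rw [h3] at h2
  rw [h1, h2, h3] at h4
  exact eq_zero_of_mul_eq_zero_of_pos (hR.pos_two hik) (hR.pos_two hil) (d := R j k)
    (by linear_combination h4)

theorem sound_fourth (hij : i ≠ j) (hik : i ≠ k) (hil : i ≠ l) (hjk : j ≠ k) (hjl : j ≠ l)
    (hkl : k ≠ l) (hi : i ∉ C) (hj : j ∉ C) (hk : k ∉ C) (hl : l ∉ C) :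
    Sound ⟨{couple i j (insert k C), couple i k (insert l C), couple i l (insert j C)},
      {couple i j C}⟩ := by
  intro S hS
  obtain ⟨R, hR⟩ := exists_isPartialCorrelation hS C
  simp only [Set.mem_insert_iff, Set.mem_singleton_iff, forall_eq_or_imp, forall_eq,
    hR.couple_holdsAt_iff hS, hR.couple_insert_holdsAt_iff hS hk,
    hR.couple_insert_holdsAt_iff hS hl, hR.couple_insert_holdsAt_iff hS hj, sub_eq_zero]
  rintro ⟨h1, h2, h3⟩
  refine eq_zero_of_eq_mul_three (hR.pos_two hjk) (hR.pos_two hjl.symm) (hR.pos_two hkl) ?_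
  rw [← h3, ← h2, ← h1]

theorem sound_fifth (hij : i ≠ j) (hik : i ≠ k) (hil : i ≠ l) (hjk : j ≠ k) (hjl : j ≠ l)
    (hkl : k ≠ l) (hi : i ∉ C) (hj : j ∉ C) (hk : k ∉ C) (hl : l ∉ C) :
    Sound ⟨{couple i j (insert k C), couple j k (insert l C), couple k l (insert i C),
      couple i l (insert j C)}, {couple i j C}⟩ := by
  intro S hS
  obtain ⟨R, hR⟩ := exists_isPartialCorrelation hS C
  simp only [Set.mem_insert_iff, Set.mem_singleton_iff, forall_eq_or_imp, forall_eq,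
    hR.couple_holdsAt_iff hS, hR.couple_insert_holdsAt_iff hS hk,
    hR.couple_insert_holdsAt_iff hS hl, hR.couple_insert_holdsAt_iff hS hi,
    hR.couple_insert_holdsAt_iff hS hj, hR.symm k i, hR.symm l i, hR.symm l j, sub_eq_zero]
  rintro ⟨h1, h2, h3, h4⟩
  refine eq_zero_of_eq_mul_sq (hR.pos_two hik) (hR.pos_two hjl) ?_
  rw [h2, h3, h4] at h1
  linear_combination h1

protected theorem sound {I : Implication m} (hI : FourIndexAxiom I) : Sound I := by
  cases hI with
  | first i j k l C hij hik hil hjk hjl hkl hi hj hk hl =>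
    exact sound_first hij hik hil hjk hjl hkl hi hj hk hl
  | second i j k l C hij hik hil hjk hjl hkl hi hj hk hl =>
    exact sound_second hij hik hil hjk hjl hkl hi hj hk hl
  | third i j k l C hij hik hil hjk hjl hkl hi hj hk hl =>
    exact sound_third hij hik hil hjk hjl hkl hi hj hk hl
  | fourth i j k l C hij hik hil hjk hjl hkl hi hj hk hl =>
    exact sound_fourth hij hik hil hjk hjl hkl hi hj hk hl
  | fifth i j k l C hij hik hil hjk hjl hkl hi hj hk hl =>
    exact sound_fifth hij hik hil hjk hjl hkl hi hj hk hl

end FourIndexAxiom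

namespace IsPartialCorrelation

variable {m : ℕ} {S R : Matrix (Fin m) (Fin m) ℝ}

theorem couple_singleton_holdsAt_iff (hR : IsPartialCorrelation S ∅ R) (hS : S.PosDef)
    {i j k : Fin m} (hij : i ≠ j) (hi : i ∉ ({k} : Finset (Fin m)))
    (hj : j ∉ ({k} : Finset (Fin m))) :
    (couple i j {k} hij hi hj).HoldsAt S ↔ R i j - R i k * R j k = 0 :=
  hR.couple_insert_holdsAt_iff hS (Finset.notMem_empty k) hij hi hj

theorem couple_pair_holdsAt_iff (hR : IsPartialCorrelation S ∅ R) (hS : S.PosDef)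
    {i j k l : Fin m} (hkl : k ≠ l) (hij : i ≠ j) (hi : i ∉ ({k, l} : Finset (Fin m)))
    (hj : j ∉ ({k, l} : Finset (Fin m))) :
    (couple i j {k, l} hij hi hj).HoldsAt S ↔
      R i j * (1 - R k l ^ 2) - R i k * (R j k - R k l * R j l)
        + R i l * (R j k * R k l - R j l) = 0 :=
  hR.couple_insert_insert_holdsAt_iff hS hkl (Finset.notMem_empty k) (Finset.notMem_empty l) hij
    hi hj

end IsPartialCorrelation

theorem sound_of_mem_newImplications {I : Implication 4} (hI : I ∈ newImplications) : Sound I := by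
  -- The conclusions follow from the premises by polynomial identities once no principal minor of
  -- the correlation matrix vanishes; no further inequality is needed.
  intro S hS
  obtain ⟨R, hR⟩ := exists_isPartialCorrelation hS ∅
  have p12 := (hR.pos_two (i := 1) (j := 2) (by decide)).ne'
  have p13 := (hR.pos_two (i := 1) (j := 3) (by decide)).ne'
  have p14 := (hR.pos_two (i := 1) (j := 4) (by decide)).ne'
  have p23 := (hR.pos_two (i := 2) (j := 3) (by decide)).ne'
  have p24 := (hR.pos_two (i := 2) (j := 4) (by decide)).ne'
  have p34 := (hR.pos_two (i := 3) (j := 4) (by decide)).ne'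
  have p123 := (hR.pos_three (i := 1) (j := 2) (k := 3) (by decide) (by decide) (by decide)).ne'
  have p124 := (hR.pos_three (i := 1) (j := 2) (k := 4) (by decide) (by decide) (by decide)).ne'
  have p134 := (hR.pos_three (i := 1) (j := 3) (k := 4) (by decide) (by decide) (by decide)).ne'
  have p234 := (hR.pos_three (i := 2) (j := 3) (k := 4) (by decide) (by decide) (by decide)).ne'
  have p1234 := (hR.pos_four (i := 1) (j := 2) (k := 3) (l := 4) (by decide) (by decide) (by decide)
    (by decide) (by decide) (by decide)).ne'
  simp only [newImplications, List.mem_cons, List.not_mem_nil, or_false] at hI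
  rcases hI with rfl | rfl | rfl | rfl | rfl | rfl | rfl | rfl | rfl | rfl | rfl | rfl | rfl <;>
  · simp only [Set.mem_insert_iff, Set.mem_singleton_iff, forall_eq_or_imp, forall_eq,
      hR.couple_holdsAt_iff hS, hR.couple_singleton_holdsAt_iff hS,
      hR.couple_pair_holdsAt_iff hS (k := 1) (l := 2) (by decide),
      hR.couple_pair_holdsAt_iff hS (k := 1) (l := 3) (by decide),
      hR.couple_pair_holdsAt_iff hS (k := 1) (l := 4) (by decide),
      hR.couple_pair_holdsAt_iff hS (k := 2) (l := 3) (by decide),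
      hR.couple_pair_holdsAt_iff hS (k := 3) (l := 4) (by decide),
      hR.symm 2 1, hR.symm 3 1, hR.symm 3 2, hR.symm 4 1, hR.symm 4 2, hR.symm 4 3]
    clear hR hS
    generalize R 1 2 = a, R 1 3 = b, R 1 4 = c, R 2 3 = d, R 2 4 = e, R 3 4 = f at *
    rintro ⟨h1, h2, h3, h4⟩
    repeat' apply And.intro
    all_goals grind

theorem FourVariableAxiom.sound {I : Implication 4} (hI : FourVariableAxiom I) : Sound I := by
  cases hI with
  | semigaussoid _ h => exact h.sound
  | fourIndex _ h => exact h.sound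
  | new π _ h => exact (sound_of_mem_newImplications h).relabel π
  | newDual π _ h => exact ((sound_of_mem_newImplications h).relabel π).dual

/-! ### Separation -/

section Certificates

variable {m : ℕ} {R R' : Type*} [CommRing R] [CommRing R']

/-- Elimination of the pivots `ks`, from left to right. -/
def eliminateAll (ks : List (Fin m)) (S : Matrix (Fin m) (Fin m) R) : Matrix (Fin m) (Fin m) R :=
  ks.foldl (fun T k => eliminate k T) S

theorem eliminate_map (f : R →+* R') (k : Fin m) (S : Matrix (Fin m) (Fin m) R) :
    (eliminate k S).map f = eliminate k (S.map f) := by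
  ext i j
  simp [eliminate, apply_ite f]

theorem eliminateAll_map (f : R →+* R') (ks : List (Fin m)) (S : Matrix (Fin m) (Fin m) R) :
    (eliminateAll ks S).map f = eliminateAll ks (S.map f) := by
  induction ks generalizing S with
  | nil => rfl
  | cons k ks ih => exact (ih _).trans (congrArg _ (eliminate_map f k S))

theorem minor_toFinset_eq_zero_iff {S : Matrix (Fin m) (Fin m) ℝ} (hS : S.PosDef) {i j : Fin m}
    {ks : List (Fin m)} (hks : ks.Nodup) (hi : i ∉ ks) (hj : j ∉ ks) :
    minor S i j ks.toFinset = 0 ↔ eliminateAll ks S i j = 0 := by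
  induction ks generalizing S with
  | nil => rw [List.toFinset_nil, minor_empty]; rfl
  | cons k ks ih =>
    rw [List.nodup_cons] at hks
    rw [List.mem_cons, not_or] at hi hj
    rw [List.toFinset_cons, minor_insert_eq_zero_iff hS.diag_pos.ne' hi.1 hj.1 (by simpa using hj.2)
      (by simpa using hks.1),
      ih ((posDef_eliminate_iff (isSymm_of_posDef hS) hS.diag_pos).2 hS) hks.2 hi.2 hj.2]
    rfl

/-- The elements of `C` in increasing order. -/
def elements (C : Finset (Fin m)) : List (Fin m) := (List.finRange m).filter (· ∈ C)

theorem mem_elements {C : Finset (Fin m)} {i : Fin m} : i ∈ elements C ↔ i ∈ C := by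
  simp [elements]

/-- The vanishing of the minor of `c` in a positive definite integer matrix, tested by elimination
of the conditioning set rather than by expansion of a determinant. -/
def Couple.EliminatesToZero (M : Matrix (Fin m) (Fin m) ℤ) (c : Couple m) : Prop :=
  ∀ i j : Fin m, c.1.1 = {i, j} → eliminateAll (elements c.1.2) M i j = 0

instance (M : Matrix (Fin m) (Fin m) ℤ) : DecidablePred (Couple.EliminatesToZero M) := fun c =>
  have (i j : Fin m) : Decidable (eliminateAll (elements c.1.2) M i j = 0) :=
    Int.instDecidableEq _ _
  inferInstanceAs
    (Decidable (∀ i j : Fin m, c.1.1 = {i, j} → eliminateAll (elements c.1.2) M i j = 0))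

theorem Couple.holdsAt_map_intCast_iff {M : Matrix (Fin m) (Fin m) ℤ}
    (hM : (M.map (Int.castRingHom ℝ)).PosDef) (c : Couple m) :
    c.HoldsAt (M.map (Int.castRingHom ℝ)) ↔ c.EliminatesToZero M := by
  refine forall₂_congr fun i j => forall_congr' fun hc => ?_
  have hdisj {k : Fin m} (hk : k ∈ c.1.1) : k ∉ elements c.1.2 := by
    rw [mem_elements]
    exact Finset.disjoint_left.1 c.2.2 hk
  have helements : (elements c.1.2).toFinset = c.1.2 := by
    ext
    rw [List.mem_toFinset, mem_elements]
  have h := minor_toFinset_eq_zero_iff hM ((List.nodup_finRange m).filter (· ∈ c.1.2))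
    (hdisj (k := i) (by simp [hc])) (hdisj (k := j) (by simp [hc]))
  rw [← elements, helements, ← eliminateAll_map] at h
  exact h.trans Int.cast_eq_zero

/-- Elimination of `ks` meets positive pivots and ends in a positive diagonal matrix. -/
def HasPositivePivots : List (Fin m) → Matrix (Fin m) (Fin m) ℤ → Prop
  | [], M => Matrix.diagonal M.diag = M ∧ ∀ i, 0 < M.diag i
  | k :: ks, M => 0 < M.diag k ∧ HasPositivePivots ks (eliminate k M)

instance decidableHasPositivePivots : (ks : List (Fin m)) → (M : Matrix (Fin m) (Fin m) ℤ) →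
    Decidable (HasPositivePivots ks M)
  | [], M => inferInstanceAs (Decidable (Matrix.diagonal M.diag = M ∧ ∀ i, 0 < M.diag i))
  | k :: ks, M =>
    have := decidableHasPositivePivots ks (eliminate k M)
    inferInstanceAs (Decidable (0 < M.diag k ∧ HasPositivePivots ks (eliminate k M)))

theorem posDef_of_hasPositivePivots {ks : List (Fin m)} {M : Matrix (Fin m) (Fin m) ℤ}
    (hM : M.IsSymm) (h : HasPositivePivots ks M) : (M.map (Int.castRingHom ℝ)).PosDef := by
  induction ks generalizing M with
  | nil =>
    rw [← h.1, Matrix.diagonal_map (map_zero _), Matrix.posDef_diagonal_iff]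
    exact fun i => Int.cast_pos.2 (h.2 i)
  | cons k ks ih =>
    have hk : 0 < (M.map (Int.castRingHom ℝ)) k k := Int.cast_pos.2 h.1
    rw [← posDef_eliminate_iff (hM.map _) hk, ← eliminate_map]
    refine ih ?_ h.2
    rw [Matrix.IsSymm, eliminate_transpose, hM.eq]

end Certificates

/-- Positive definite matrices, found by computer. Their images under relabelling and duality
separate every couple from every relation that is closed under the axioms and does not contain
it. -/
def matrices : List (Matrix (Fin 4) (Fin 4) ℤ) := [
  !![2, -1, 0, 0; -1, 2, 1, 0; 0, 1, 2, 1; 0, 0, 1, 1],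
  !![1, 1, 0, 0; 1, 3, 1, 1; 0, 1, 1, 1; 0, 1, 1, 2],
  !![2, 1, 2, -2; 1, 3, 3, -1; 2, 3, 6, -1; -2, -1, -1, 3],
  !![2, -1, 0, 0; -1, 2, 0, -1; 0, 0, 1, 0; 0, -1, 0, 1],
  !![1, -1, 0, 0; -1, 2, 0, 0; 0, 0, 2, 0; 0, 0, 0, 1],
  !![2, 1, 0, 1; 1, 1, 1, 1; 0, 1, 6, 3; 1, 1, 3, 3],
  !![4, 1, 2, 2; 1, 3, 3, 1; 2, 3, 6, 1; 2, 1, 1, 2],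
  !![1, 0, 1, 1; 0, 1, 1, 1; 1, 1, 6, 1; 1, 1, 1, 5],
  !![2, -1, 1, 0; -1, 6, 1, 1; 1, 1, 2, 1; 0, 1, 1, 1],
  !![4, -1, 1, 2; -1, 1, -1, -1; 1, -1, 4, 0; 2, -1, 0, 2],
  !![1, 1, 0, -1; 1, 5, 1, 1; 0, 1, 1, 1; -1, 1, 1, 5],
  !![4, -1, -1, 0; -1, 1, 1, -1; -1, 1, 2, -3; 0, -1, -3, 6],
  !![2, 1, 1, 0; 1, 2, 1, 1; 1, 1, 2, 0; 0, 1, 0, 1],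
  !![2, 1, 0, 1; 1, 3, 0, 1; 0, 0, 3, -1; 1, 1, -1, 1],
  !![2, 2, 0, 1; 2, 4, 1, 0; 0, 1, 1, -1; 1, 0, -1, 2],
  !![1, 1, 1, 0; 1, 3, 0, 1; 1, 0, 2, -1; 0, 1, -1, 2]]

theorem posDef_of_mem_matrices {M : Matrix (Fin 4) (Fin 4) ℤ} (hM : M ∈ matrices) :
    (M.map (Int.castRingHom ℝ)).PosDef := by
  have key : ∀ M ∈ matrices, M.IsSymm ∧ HasPositivePivots (List.finRange 4) M := by decide +kernel
  exact posDef_of_hasPositivePivots (key M hM).1 (key M hM).2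

section Relabelling

variable {m : ℕ}

theorem Couple.relabel_relabel (π σ : Equiv.Perm (Fin m)) (c : Couple m) :
    (c.relabel σ).relabel π = c.relabel (π * σ) :=
  Subtype.ext (Prod.ext (Finset.map_map _ _ _) (Finset.map_map _ _ _))

theorem Couple.relabel_dual (π : Equiv.Perm (Fin m)) (c : Couple m) :
    c.dual.relabel π = (c.relabel π).dual := by
  refine Subtype.ext (Prod.ext rfl ?_)
  ext x
  simp only [Couple.relabel, Couple.dual, Finset.mem_map_equiv, Finset.mem_compl,
    Finset.mem_union]

theorem Couple.relabel_injective (π : Equiv.Perm (Fin m)) :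
    Function.Injective (Couple.relabel π) := fun _ _ h =>
  Subtype.ext (Prod.ext (Finset.map_injective _ (congrArg (·.1.1) h))
    (Finset.map_injective _ (congrArg (·.1.2) h)))

theorem Implication.relabel_relabel (π σ : Equiv.Perm (Fin m)) (I : Implication m) :
    (I.relabel σ).relabel π = I.relabel (π * σ) := by
  simp only [Implication.relabel, Set.image_image, Couple.relabel_relabel]

theorem Implication.relabel_dual (π : Equiv.Perm (Fin m)) (I : Implication m) :
    I.dual.relabel π = (I.relabel π).dual := by
  simp only [Implication.relabel, Implication.dual, Set.image_image, Couple.relabel_dual]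

theorem Satisfies.preimage_relabel {L : Relation m} {I : Implication m} {π : Equiv.Perm (Fin m)}
    (h : Satisfies L (I.relabel π)) : Satisfies (Couple.relabel π ⁻¹' L) I := by
  simpa only [Satisfies, Implication.relabel, Set.image_subset_iff] using h

theorem SemigaussoidAxiom.relabel {I : Implication m} (hI : SemigaussoidAxiom I)
    (π : Equiv.Perm (Fin m)) : SemigaussoidAxiom (I.relabel π) := by
  cases hI
  all_goals
    simp only [Implication.relabel, Set.image_insert_eq, Set.image_singleton,
      Couple.relabel_couple, Finset.map_insert]
    constructor <;> simpa

theorem FourIndexAxiom.relabel {I : Implication m} (hI : FourIndexAxiom I)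
    (π : Equiv.Perm (Fin m)) : FourIndexAxiom (I.relabel π) := by
  cases hI
  all_goals
    simp only [Implication.relabel, Set.image_insert_eq, Set.image_singleton,
      Couple.relabel_couple, Finset.map_insert]
    constructor <;> simpa

end Relabelling

theorem FourVariableAxiom.relabel {I : Implication 4} (hI : FourVariableAxiom I)
    (π : Equiv.Perm (Fin 4)) : FourVariableAxiom (I.relabel π) := by
  cases hI with
  | semigaussoid _ h => exact .semigaussoid _ (h.relabel π)
  | fourIndex _ h => exact .fourIndex _ (h.relabel π)
  | new σ _ h => rw [Implication.relabel_relabel]; exact .new _ _ h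
  | newDual σ _ h =>
    rw [Implication.relabel_dual, Implication.relabel_relabel]
    exact .newDual _ _ h

/-- Premises and conclusions of an implication on four variables, as lists. -/
abbrev Template : Type := List (Couple 4) × List (Couple 4)

/-- The implication with the listed premises and conclusions. -/
def Template.toImplication (t : Template) : Implication 4 := ⟨{c | c ∈ t.1}, {c | c ∈ t.2}⟩

/-- The template obtained by applying the permutation `π` to all indices. -/
def Template.relabel (π : Equiv.Perm (Fin 4)) (t : Template) : Template :=
  (t.1.map (Couple.relabel π), t.2.map (Couple.relabel π))

/-- The template in which all couples are replaced by their duals. -/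
def Template.dual (t : Template) : Template := (t.1.map Couple.dual, t.2.map Couple.dual)

theorem Template.toImplication_relabel (π : Equiv.Perm (Fin 4)) (t : Template) :
    (t.relabel π).toImplication = t.toImplication.relabel π := by
  simp only [Template.toImplication, Template.relabel, Implication.relabel, List.mem_map]
  rfl

theorem Template.toImplication_dual (t : Template) :
    t.dual.toImplication = t.toImplication.dual := by
  simp only [Template.toImplication, Template.dual, Implication.dual, List.mem_map]
  rfl

/-- Representatives, up to relabelling, of the semigaussoid and four-index implications on four
variables. -/
def baseTemplates : List Template := [
  ([couple 1 2 ∅, couple 1 3 ∅],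
    [couple 1 2 {3}, couple 1 3 {2}]),
  ([couple 1 2 ∅, couple 1 3 {2}],
    [couple 1 3 ∅, couple 1 2 {3}]),
  ([couple 1 2 {3}, couple 1 3 {2}],
    [couple 1 2 ∅, couple 1 3 ∅]),
  ([couple 1 2 {4}, couple 1 3 {4}],
    [couple 1 2 {3, 4}, couple 1 3 {2, 4}]),
  ([couple 1 2 {4}, couple 1 3 {2, 4}],
    [couple 1 3 {4}, couple 1 2 {3, 4}]),
  ([couple 1 2 {3, 4}, couple 1 3 {2, 4}],
    [couple 1 2 {4}, couple 1 3 {4}]),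
  ([couple 1 2 ∅, couple 3 4 ∅, couple 1 3 {2, 4}, couple 2 4 {1, 3}],
    [couple 1 3 ∅]),
  ([couple 1 2 ∅, couple 3 4 {1}, couple 3 4 {2}, couple 1 2 {3, 4}],
    [couple 3 4 ∅]),
  ([couple 1 2 ∅, couple 2 4 {3}, couple 3 4 {1}, couple 1 3 {2, 4}],
    [couple 1 3 ∅]),
  ([couple 1 2 {3}, couple 1 3 {4}, couple 1 4 {2}],
    [couple 1 2 ∅]),
  ([couple 1 2 {3}, couple 2 3 {4}, couple 3 4 {1}, couple 1 4 {2}],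
    [couple 1 2 ∅])]

/-- The implications of `newImplications`, in the same order. -/
def newTemplates : List Template := [
  ([couple 2 3 {4}, couple 2 3 {1, 4}, couple 2 4 {1}, couple 3 4 {1}],
    [couple 2 3 ∅, couple 2 3 {1}, couple 2 4 {1, 3}, couple 3 4 {1, 2}]),
  ([couple 2 3 ∅, couple 2 3 {1}, couple 2 4 {1}, couple 3 4 {1}],
    [couple 2 3 {4}, couple 2 3 {1, 4}, couple 2 4 {1, 3}, couple 3 4 {1, 2}]),
  ([couple 1 4 {2}, couple 1 4 {3}, couple 1 4 {2, 3}, couple 2 3 {1, 4}],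
    [couple 1 4 ∅]),
  ([couple 1 4 ∅, couple 1 4 {2}, couple 1 4 {2, 3}, couple 2 3 {1, 4}],
    [couple 1 4 {3}]),
  ([couple 1 4 ∅, couple 1 4 {2}, couple 1 4 {3}, couple 2 3 {1, 4}],
    [couple 1 4 {2, 3}]),
  ([couple 1 4 ∅, couple 1 4 {2, 3}, couple 2 3 {1}, couple 2 3 {1, 4}],
    [couple 1 4 {2}, couple 1 4 {3}]),
  ([couple 1 4 {2}, couple 1 4 {3}, couple 2 3 {1}, couple 2 3 {1, 4}],
    [couple 1 4 ∅, couple 1 4 {2, 3}]),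
  ([couple 1 2 ∅, couple 1 4 {3}, couple 1 4 {2, 3}, couple 2 3 {1, 4}],
    [couple 1 2 {3}, couple 1 2 {4}, couple 1 2 {3, 4}, couple 2 3 {4}]),
  ([couple 1 2 ∅, couple 1 4 {3}, couple 2 3 {4}, couple 2 3 {1, 4}],
    [couple 1 2 {3}, couple 1 2 {4}, couple 1 2 {3, 4}, couple 1 4 {2, 3}]),
  ([couple 1 2 {3}, couple 1 4 {2}, couple 2 3 {4}, couple 2 3 {1, 4}],
    [couple 1 2 ∅, couple 1 2 {4}, couple 1 2 {3, 4}, couple 1 4 ∅]),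
  ([couple 1 2 {3}, couple 1 4 ∅, couple 1 4 {2}, couple 2 3 {1, 4}],
    [couple 1 2 ∅, couple 1 2 {4}, couple 1 2 {3, 4}, couple 2 3 {4}]),
  ([couple 1 4 {2}, couple 2 3 {1}, couple 2 3 {4}, couple 2 3 {1, 4}],
    [couple 2 3 ∅]),
  ([couple 1 4 {2}, couple 2 3 ∅, couple 2 3 {1}, couple 2 3 {1, 4}],
    [couple 2 3 {4}])]

theorem fourVariableAxiom_of_mem_baseTemplates {t : Template} (ht : t ∈ baseTemplates) :
    FourVariableAxiom t.toImplication := by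
  simp only [baseTemplates, List.mem_cons, List.not_mem_nil, or_false] at ht
  rcases ht with rfl | rfl | rfl | rfl | rfl | rfl | rfl | rfl | rfl | rfl | rfl <;>
    simp only [Template.toImplication, List.setOfPred_mem_cons, List.not_mem_nil,
      Set.ofPred_false, insert_empty_eq]
  · refine .semigaussoid _ (.weakUnion 1 2 3 ∅ ?_ ?_ ?_ ?_ ?_ ?_) <;> decide
  · refine .semigaussoid _ (.contraction 1 2 3 ∅ ?_ ?_ ?_ ?_ ?_ ?_) <;> decide
  · refine .semigaussoid _ (.intersection 1 2 3 ∅ ?_ ?_ ?_ ?_ ?_ ?_) <;> decide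
  · refine .semigaussoid _ (.weakUnion 1 2 3 {4} ?_ ?_ ?_ ?_ ?_ ?_) <;> decide
  · refine .semigaussoid _ (.contraction 1 2 3 {4} ?_ ?_ ?_ ?_ ?_ ?_) <;> decide
  · refine .semigaussoid _ (.intersection 1 2 3 {4} ?_ ?_ ?_ ?_ ?_ ?_) <;> decide
  · refine .fourIndex _ (.first 1 2 3 4 ∅ ?_ ?_ ?_ ?_ ?_ ?_ ?_ ?_ ?_ ?_) <;> decide
  · refine .fourIndex _ (.second 1 2 3 4 ∅ ?_ ?_ ?_ ?_ ?_ ?_ ?_ ?_ ?_ ?_) <;> decide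
  · refine .fourIndex _ (.third 1 2 3 4 ∅ ?_ ?_ ?_ ?_ ?_ ?_ ?_ ?_ ?_ ?_) <;> decide
  · refine .fourIndex _ (.fourth 1 2 3 4 ∅ ?_ ?_ ?_ ?_ ?_ ?_ ?_ ?_ ?_ ?_) <;> decide
  · refine .fourIndex _ (.fifth 1 2 3 4 ∅ ?_ ?_ ?_ ?_ ?_ ?_ ?_ ?_ ?_ ?_) <;> decide

theorem map_toImplication_newTemplates :
    newTemplates.map Template.toImplication = newImplications := by
  simp only [newTemplates, newImplications, List.map_cons, List.map_nil, Template.toImplication,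
    List.setOfPred_mem_cons, List.not_mem_nil, Set.ofPred_false, insert_empty_eq]

/-- The templates of all axioms on four variables: all relabellings of the representatives and,
for the new implications, their duals. -/
def axiomTemplates : List Template :=
  (permsOfList (List.finRange 4)).flatMap fun π =>
    (baseTemplates ++ newTemplates).map (Template.relabel π) ++
      newTemplates.map fun t => (t.relabel π).dual

theorem fourVariableAxiom_of_mem_axiomTemplates {t : Template} (ht : t ∈ axiomTemplates) :
    FourVariableAxiom t.toImplication := by
  have hnew {t : Template} (ht : t ∈ newTemplates) : t.toImplication ∈ newImplications :=
    map_toImplication_newTemplates ▸ List.mem_map_of_mem ht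
  simp only [axiomTemplates, List.mem_flatMap, List.mem_append, List.mem_map] at ht
  obtain ⟨π, -, ⟨t, ht | ht, rfl⟩ | ⟨t, ht, rfl⟩⟩ := ht
  · rw [Template.toImplication_relabel]
    exact (fourVariableAxiom_of_mem_baseTemplates ht).relabel π
  · rw [Template.toImplication_relabel]
    exact .new π _ (hnew ht)
  · rw [Template.toImplication_dual, Template.toImplication_relabel]
    exact .newDual π _ (hnew ht)

/-- The 24 couples on four variables. -/
def couples : List (Couple 4) := [
  couple 1 2 ∅, couple 1 2 {3}, couple 1 2 {4}, couple 1 2 {3, 4},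
  couple 1 3 ∅, couple 1 3 {2}, couple 1 3 {4}, couple 1 3 {2, 4},
  couple 2 3 ∅, couple 2 3 {1}, couple 2 3 {4}, couple 2 3 {1, 4},
  couple 1 4 ∅, couple 1 4 {2}, couple 1 4 {3}, couple 1 4 {2, 3},
  couple 2 4 ∅, couple 2 4 {1}, couple 2 4 {3}, couple 2 4 {1, 3},
  couple 3 4 ∅, couple 3 4 {1}, couple 3 4 {2}, couple 3 4 {1, 2}]

theorem mem_couples (c : Couple 4) : c ∈ couples := by
  revert c
  decide +kernel

/-- The position of a couple in `couples`. -/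
def Couple.code (c : Couple 4) : ℕ := couples.idxOf c

theorem Couple.code_injective : Function.Injective Couple.code := fun c _ h =>
  (List.idxOf_inj (mem_couples c)).1 h

/-- The set of positions of the ones in the binary expansion of `n`. -/
def bits (n : ℕ) : Set ℕ := {x | n.testBit x}

theorem mem_bits {n x : ℕ} : x ∈ bits n ↔ n.testBit x := Iff.rfl

/-- The set of couples in `cs`, as the number with binary ones at the codes of its elements. -/
def mask (cs : List (Couple 4)) : ℕ := cs.foldr (fun c n => 2 ^ c.code ||| n) 0

theorem bits_mask (cs : List (Couple 4)) : bits (mask cs) = Couple.code '' {c | c ∈ cs} := by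
  induction cs with
  | nil => simp [bits, mask]
  | cons c cs ih =>
    rw [List.setOfPred_mem_cons, Set.image_insert_eq, ← ih]
    ext x
    simp [mem_bits, mask, Nat.testBit_two_pow, @eq_comm _ x]

/-- Application of `f` to `n`. Kernel reduction is call-by-name, so that a mere `f n` would
recompute `n` at each of its occurrences in `f n`; the case distinction forces its evaluation. -/
def force {α : Type*} (n : ℕ) (f : ℕ → α) : α :=
  match n with
  | 0 => f 0
  | k + 1 => f (k + 1)

theorem force_eq {α : Type*} (n : ℕ) (f : ℕ → α) : force n f = f n := by
  cases n <;> rfl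

/-- `l.map f`, with the values of `f` evaluated. -/
def evalMap {α : Type*} (f : α → ℕ) : List α → List ℕ
  | [] => []
  | a :: l => force (f a) fun n => n :: evalMap f l

theorem evalMap_eq_map {α : Type*} (f : α → ℕ) (l : List α) : evalMap f l = l.map f := by
  induction l with
  | nil => rfl
  | cons a l ih => rw [evalMap, force_eq, ih, List.map_cons]

/-- The pairs of the premise mask of an axiom and the code of one of its conclusions. -/
def rules : List (ℕ × ℕ) :=
  axiomTemplates.flatMap fun t => force (mask t.1) fun P => t.2.map fun c => (P, c.code)

/-- The masks of the premises of all axioms with the couple of code `x` as a conclusion. -/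
def premises (x : ℕ) : List ℕ := evalMap Prod.fst (rules.filter (Nat.beq x ·.2))

theorem mem_code_image_of_mem_premises {L : Relation 4}
    (hL : ∀ I, FourVariableAxiom I → Satisfies L I) {x P : ℕ} (hP : P ∈ premises x)
    (hPL : bits P ⊆ Couple.code '' L) : x ∈ Couple.code '' L := by
  simp only [premises, evalMap_eq_map, rules, force_eq, List.mem_map, List.mem_filter,
    List.mem_flatMap] at hP
  obtain ⟨_, ⟨⟨t, ht, c, hc, rfl⟩, hx⟩, rfl⟩ := hP
  rw [bits_mask, Set.image_subset_image_iff Couple.code_injective] at hPL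
  rw [Nat.eq_of_beq_eq_true hx]
  exact Set.mem_image_of_mem _ (hL _ (fourVariableAxiom_of_mem_axiomTemplates ht) hPL hc)

section Search

/-- The mask of the set difference `P \ K`. -/
def missing (P K : ℕ) : ℕ := P ^^^ (P &&& K)

/-- Whether `K` and `P` are masks of disjoint sets. -/
def avoids (K P : ℕ) : Bool := Nat.beq (P &&& K) 0

/-- Whether `N` is the mask of a subset of the set with mask `K`. -/
def isCoveredBy (K N : ℕ) : Bool := Nat.beq (N ||| K) K

theorem bits_subset_of_missing_eq_zero {P K : ℕ} (h : missing P K = 0) : bits P ⊆ bits K := by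
  intro x hP
  have hx := congrArg (Nat.testBit · x) (Nat.xor_eq_zero_iff.1 h)
  simp only [mem_bits, Nat.testBit_and] at *
  grind

theorem bits_subset_of_isCoveredBy {K N : ℕ} (h : isCoveredBy K N) : bits N ⊆ bits K := by
  intro x hN
  have hx := congrArg (Nat.testBit · x) (Nat.eq_of_beq_eq_true h)
  simp only [mem_bits, Nat.testBit_or] at *
  grind

theorem bits_lor_two_pow (x n : ℕ) : bits (n ||| 2 ^ x) = insert x (bits n) := by
  ext y
  simp [mem_bits, Nat.testBit_two_pow, @eq_comm _ x, or_comm]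

/-- The smallest of the masks `missing P ins` for `P` in `forbidden`, or `2 ^ 24` if `forbidden` is
empty. -/
def leastMissing (ins : ℕ) (forbidden : List ℕ) : ℕ :=
  forbidden.foldr (fun P d => min (missing P ins) d) (2 ^ 24)

theorem exists_missing_eq_zero {ins : ℕ} {forbidden : List ℕ}
    (h : leastMissing ins forbidden = 0) : ∃ P ∈ forbidden, missing P ins = 0 := by
  induction forbidden with
  | nil => simp [leastMissing] at h
  | cons P forbidden ih =>
    rw [leastMissing, List.foldr_cons, Nat.min_eq_zero_iff] at h
    rcases h with h | h
    · exact ⟨P, List.mem_cons_self, h⟩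
    · obtain ⟨Q, hQ, hQ0⟩ := ih h
      exact ⟨Q, List.mem_cons_of_mem _ hQ, hQ0⟩

/-- A backtracking search of depth at most the first argument. It succeeds if every set `L` of
codes that is closed under the rules `premises`, contains `ins`, does not contain any set in
`forbidden` and is disjoint from `outs`, is disjoint from some set in `failing`; all these sets are
given by their masks. -/
def search (premises : ℕ → List ℕ) : ℕ → ℕ → ℕ → List ℕ → List ℕ → Bool
  | 0, _, _, _, _ => false
  | n + 1, ins, outs, forbidden, failing =>
    failing.any (isCoveredBy outs) ||
    -- Branch on the highest code missing from the forbidden set that is closest to being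
    -- contained in `ins`: putting it into `L` soon leads to a contradiction.
    force (leastMissing ins forbidden) fun d => Nat.beq d 0 ||
    force (Nat.log2 d) fun x => force (2 ^ x) fun b =>
      force (outs ||| b) (fun outs => search premises n ins outs
        ((premises x ++ forbidden).filter (avoids outs)) failing) &&
      force (ins ||| b) fun ins => search premises n ins outs
        forbidden (failing.filter (avoids b))

theorem exists_disjoint_of_search {premises : ℕ → List ℕ} {L : Set ℕ}
    (closed : ∀ x, ∀ P ∈ premises x, bits P ⊆ L → x ∈ L) {n ins outs : ℕ}
    {forbidden failing : List ℕ} (h : search premises n ins outs forbidden failing = true)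
    (hins : bits ins ⊆ L) (houts : Disjoint (bits outs) L)
    (hforbidden : ∀ P ∈ forbidden, ¬ bits P ⊆ L) : ∃ N ∈ failing, Disjoint (bits N) L := by
  induction n generalizing ins outs forbidden failing with
  | zero => exact absurd h Bool.false_ne_true
  | succ n ih =>
    simp only [search, force_eq, Bool.or_eq_true, Bool.and_eq_true, List.any_eq_true] at h
    rcases h with ⟨N, hN, hNouts⟩ | h | ⟨hout, hin⟩
    · exact ⟨N, hN, houts.mono_left (bits_subset_of_isCoveredBy hNouts)⟩
    · obtain ⟨P, hP, hPins⟩ := exists_missing_eq_zero (Nat.eq_of_beq_eq_true h)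
      exact absurd ((bits_subset_of_missing_eq_zero hPins).trans hins) (hforbidden P hP)
    · set x := (leastMissing ins forbidden).log2
      by_cases hx : x ∈ L
      · obtain ⟨N, hN, hNL⟩ := ih hin
          (by rw [bits_lor_two_pow]; exact Set.insert_subset hx hins) houts hforbidden
        exact ⟨N, List.mem_of_mem_filter hN, hNL⟩
      · refine ih hout hins ?_ fun P hP => ?_
        · rw [bits_lor_two_pow]
          exact Set.disjoint_insert_left.2 ⟨hx, houts⟩
        · rcases List.mem_append.1 (List.mem_of_mem_filter hP) with hP | hP
          · exact fun hPL => hx (closed x P hP hPL)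
          · exact hforbidden P hP

end Search

section Realizations

variable {m : ℕ} {S : Matrix (Fin m) (Fin m) ℝ}

theorem exists_posDef_relabel_holdsAt_iff (hS : S.PosDef) (π : Equiv.Perm (Fin m)) :
    ∃ T : Matrix (Fin m) (Fin m) ℝ, T.PosDef ∧
      ∀ c : Couple m, (c.relabel π).HoldsAt T ↔ c.HoldsAt S := by
  refine ⟨S.submatrix π.symm π.symm, hS.submatrix π.symm.injective, fun c => ?_⟩
  rw [Couple.relabel_holdsAt_iff, Matrix.submatrix_submatrix, Equiv.symm_comp_self,
    Matrix.submatrix_id_id]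

theorem exists_posDef_dual_holdsAt_iff (hS : S.PosDef) :
    ∃ T : Matrix (Fin m) (Fin m) ℝ, T.PosDef ∧
      ∀ c : Couple m, c.dual.HoldsAt T ↔ c.HoldsAt S := by
  refine ⟨S⁻¹, hS.inv, fun c => ?_⟩
  rw [Couple.dual_holdsAt_iff c hS.inv, Matrix.nonsing_inv_nonsing_inv _ hS.det_pos.ne'.isUnit]

theorem Couple.relabel_bijective (π : Equiv.Perm (Fin m)) :
    Function.Bijective (Couple.relabel π) :=
  Finite.injective_iff_bijective.1 (Couple.relabel_injective π)

theorem Couple.dual_bijective : Function.Bijective (Couple.dual (m := m)) :=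
  Function.Involutive.bijective Couple.dual_dual

end Realizations

/-- The 48 symmetries of the set of couples on four variables: relabellings and their compositions
with duality. -/
def symmetries : List (Couple 4 → Couple 4) :=
  (permsOfList (List.finRange 4)).flatMap fun π =>
    [Couple.relabel π, Couple.dual ∘ Couple.relabel π]

theorem bijective_of_mem_symmetries {σ : Couple 4 → Couple 4} (hσ : σ ∈ symmetries) :
    Function.Bijective σ := by
  simp only [symmetries, List.mem_flatMap, List.mem_cons, List.not_mem_nil, or_false] at hσ
  obtain ⟨π, -, rfl | rfl⟩ := hσ
  · exact Couple.relabel_bijective π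
  · exact Couple.dual_bijective.comp (Couple.relabel_bijective π)

theorem exists_posDef_symmetry_holdsAt_iff {S : Matrix (Fin 4) (Fin 4) ℝ} (hS : S.PosDef)
    {σ : Couple 4 → Couple 4} (hσ : σ ∈ symmetries) :
    ∃ T : Matrix (Fin 4) (Fin 4) ℝ, T.PosDef ∧ ∀ c, (σ c).HoldsAt T ↔ c.HoldsAt S := by
  simp only [symmetries, List.mem_flatMap, List.mem_cons, List.not_mem_nil, or_false] at hσ
  obtain ⟨π, -, rfl | rfl⟩ := hσ
  · exact exists_posDef_relabel_holdsAt_iff hS π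
  · obtain ⟨T, hT, hTS⟩ := exists_posDef_relabel_holdsAt_iff hS π
    obtain ⟨U, hU, hUT⟩ := exists_posDef_dual_holdsAt_iff hT
    exact ⟨U, hU, fun c => (hUT _).trans (hTS c)⟩

/-- The masks of the sets of couples failing at the images of the matrices in `matrices` under all
symmetries. -/
def failures : List ℕ :=
  matrices.flatMap fun M =>
    (fun cs => evalMap (fun σ => mask (cs.map σ)) symmetries)
      (couples.filter (¬ Couple.EliminatesToZero M ·))

theorem exists_posDef_of_mem_failures {N : ℕ} (hN : N ∈ failures) :
    ∃ T : Matrix (Fin 4) (Fin 4) ℝ, T.PosDef ∧ ∀ c : Couple 4, c.HoldsAt T ↔ c.code ∉ bits N := by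
  simp only [failures, evalMap_eq_map, List.mem_flatMap, List.mem_map] at hN
  obtain ⟨M, hM, σ, hσ, rfl⟩ := hN
  obtain ⟨T, hT, hTM⟩ := exists_posDef_symmetry_holdsAt_iff (posDef_of_mem_matrices hM) hσ
  refine ⟨T, hT, fun c => ?_⟩
  obtain ⟨c, rfl⟩ := (bijective_of_mem_symmetries hσ).surjective c
  rw [hTM, Couple.holdsAt_map_intCast_iff (posDef_of_mem_matrices hM), bits_mask,
    Couple.code_injective.mem_set_image, Set.mem_ofPred_eq,
    List.mem_map_of_injective (bijective_of_mem_symmetries hσ).injective, List.mem_filter,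
    decide_eq_true_iff, not_and_not_right]
  exact ⟨fun h _ => h, fun h => h (mem_couples c)⟩

/-- Representatives of the couples on four variables up to relabelling. -/
def orbitRepresentatives : List (Couple 4) := [couple 1 2 ∅, couple 1 2 {3}, couple 1 2 {3, 4}]

theorem exists_relabel_orbitRepresentative (c : Couple 4) :
    ∃ c₀ ∈ orbitRepresentatives, ∃ π, c = c₀.relabel π := by
  have key : ∀ c ∈ couples, ∃ c₀ ∈ orbitRepresentatives, ∃ π ∈ permsOfList (List.finRange 4),
      c = c₀.relabel π := by decide +kernel
  obtain ⟨c₀, hc₀, π, -, hπ⟩ := key c (mem_couples c)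
  exact ⟨c₀, hc₀, π, hπ⟩

/-- The positive definite matrix `S` separates the couple `c` from the relation `L`. -/
def Separates (S : Matrix (Fin 4) (Fin 4) ℝ) (L : Relation 4) (c : Couple 4) : Prop :=
  S.PosDef ∧ (∀ d ∈ L, d.HoldsAt S) ∧ ¬ c.HoldsAt S

set_option maxRecDepth 100000 in
theorem search_orbitRepresentatives : ∀ c ∈ orbitRepresentatives,
    search premises 24 0 (2 ^ c.code) (premises c.code)
      (failures.filter (·.testBit c.code)) = true := by
  decide +kernel

theorem bits_two_pow (x : ℕ) : bits (2 ^ x) = {x} := by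
  ext y
  simp [mem_bits, Nat.testBit_two_pow, eq_comm]

theorem exists_separates_of_mem_orbitRepresentatives {L : Relation 4}
    (hL : ∀ I, FourVariableAxiom I → Satisfies L I) {c : Couple 4} (hc : c ∈ orbitRepresentatives)
    (hcL : c ∉ L) : ∃ S, Separates S L c := by
  have hcode : c.code ∉ Couple.code '' L := by rwa [Couple.code_injective.mem_set_image]
  obtain ⟨N, hN, hNL⟩ := exists_disjoint_of_search
    (fun _ _ => mem_code_image_of_mem_premises hL) (search_orbitRepresentatives c hc)
    (by simp [bits]) (by rwa [bits_two_pow, Set.disjoint_singleton_left])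
    fun P hP hPL => hcode (mem_code_image_of_mem_premises hL hP hPL)
  obtain ⟨hNfailures, hcN⟩ := List.mem_filter.1 hN
  obtain ⟨S, hS, hSN⟩ := exists_posDef_of_mem_failures hNfailures
  exact ⟨S, hS, fun d hd => (hSN d).2 (Set.disjoint_right.1 hNL (Set.mem_image_of_mem _ hd)),
    fun h => (hSN c).1 h hcN⟩

theorem exists_separates_of_notMem {L : Relation 4}
    (hL : ∀ I, FourVariableAxiom I → Satisfies L I) {c : Couple 4} (hc : c ∉ L) :
    ∃ S, Separates S L c := by
  obtain ⟨c₀, hc₀, π, rfl⟩ := exists_relabel_orbitRepresentative c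
  obtain ⟨S, hS, hSL, hSc⟩ := exists_separates_of_mem_orbitRepresentatives
    (fun I hI => (hL _ (hI.relabel π)).preimage_relabel) hc₀ hc
  obtain ⟨T, hT, hTS⟩ := exists_posDef_relabel_holdsAt_iff hS π
  refine ⟨T, hT, fun d hd => ?_, fun h => hSc ((hTS c₀).1 h)⟩
  obtain ⟨d, rfl⟩ := (Couple.relabel_bijective π).surjective d
  exact (hTS d).2 (hSL d hd)

theorem isComplete_iff (L : Relation 4) :
    IsComplete L ↔ ∀ I, FourVariableAxiom I → Satisfies L I := by
  constructor
  · intro h I hI hp c hc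
    rw [h]
    exact fun S hS => hI.sound S hS.1 (fun d hd => hS.2 d (hp hd)) c hc
  · intro h
    refine Set.Subset.antisymm (fun c hc S hS => hS.2 c hc) fun c hc => ?_
    by_contra hcL
    obtain ⟨S, hS, hSL, hSc⟩ := exists_separates_of_notMem h hcL
    exact hSc (hc S ⟨hS, hSL⟩)

section Disjoint

variable {m : ℕ} {I : Implication m}

theorem isCIImplication_iff : IsCIImplication I ↔ Disjoint I.premise I.conclusion ∧ Sound I := by
  refine and_congr_right fun _ => ⟨fun h S hS hp c hc => ?_, fun h => ?_⟩
  · have : S ∈ Vpd (I.premise ∪ I.conclusion) := h ▸ ⟨hS, hp⟩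
    exact this.2 c (.inr hc)
  · refine Set.Subset.antisymm (fun S hS => ⟨hS.1, ?_⟩) fun S hS =>
      ⟨hS.1, fun c hc => hS.2 c (.inl hc)⟩
    rintro c (hc | hc)
    exacts [hS.2 c hc, h S hS.1 hS.2 c hc]

theorem disjoint_relabel (h : Disjoint I.premise I.conclusion) (π : Equiv.Perm (Fin m)) :
    Disjoint (I.relabel π).premise (I.relabel π).conclusion :=
  (Set.disjoint_image_iff (Couple.relabel_injective π)).2 h

theorem disjoint_dual (h : Disjoint I.premise I.conclusion) :
    Disjoint I.dual.premise I.dual.conclusion :=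
  (Set.disjoint_image_iff Couple.dual_bijective.injective).2 h

theorem couple_eq_couple_iff {i j i' j' : Fin m} {C D : Finset (Fin m)}
    {hij hi hj hij' hi' hj'} : couple i j C hij hi hj = couple i' j' D hij' hi' hj' ↔
      (i = i' ∧ j = j' ∨ i = j' ∧ j = i') ∧ C = D := by
  rw [← pair_eq_pair_iff, couple, couple, Subtype.mk.injEq, Prod.mk.injEq]

theorem SemigaussoidAxiom.disjoint (hI : SemigaussoidAxiom I) :
    Disjoint I.premise I.conclusion := by
  cases hI
  all_goals
    simp only [Set.disjoint_insert_left, Set.disjoint_singleton_left, Set.mem_insert_iff,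
      Set.mem_singleton_iff, couple_eq_couple_iff]
    grind [Finset.insert_eq_self]

theorem FourIndexAxiom.disjoint (hI : FourIndexAxiom I) : Disjoint I.premise I.conclusion := by
  cases hI
  all_goals
    simp only [Set.disjoint_insert_left, Set.disjoint_singleton_left, Set.mem_singleton_iff,
      couple_eq_couple_iff]
    grind

end Disjoint

theorem disjoint_of_mem_newTemplates {t : Template} (ht : t ∈ newTemplates) :
    Disjoint t.toImplication.premise t.toImplication.conclusion := by
  have key : ∀ t ∈ newTemplates, ∀ c ∈ t.1, c ∉ t.2 := by decide +kernel
  exact Set.disjoint_left.2 fun c => key t ht c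

theorem disjoint_of_mem_newImplications {I : Implication 4} (hI : I ∈ newImplications) :
    Disjoint I.premise I.conclusion := by
  rw [← map_toImplication_newTemplates] at hI
  obtain ⟨t, ht, rfl⟩ := List.mem_map.1 hI
  exact disjoint_of_mem_newTemplates ht

theorem FourVariableAxiom.disjoint {I : Implication 4} (hI : FourVariableAxiom I) :
    Disjoint I.premise I.conclusion := by
  cases hI with
  | semigaussoid _ h => exact h.disjoint
  | fourIndex _ h => exact h.disjoint
  | new π _ h => exact disjoint_relabel (disjoint_of_mem_newImplications h) π
  | newDual π _ h => exact disjoint_dual (disjoint_relabel (disjoint_of_mem_newImplications h) π)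

theorem Deducible.holdsAt {A : Set (Implication 4)} (hA : ∀ I ∈ A, Sound I) {K : Relation 4}
    {c : Couple 4} (h : Deducible A K c) {S : Matrix (Fin 4) (Fin 4) ℝ} (hS : S.PosDef)
    (hK : ∀ d ∈ K, d.HoldsAt S) : c.HoldsAt S := by
  induction h with
  | hyp c hc => exact hK c hc
  | step I hI _ c hc ih => exact hA I hI S hS ih c hc

theorem sound_iff_deducible (I : Implication 4) :
    Sound I ↔ ∀ c ∈ I.conclusion, Deducible {J | FourVariableAxiom J} I.premise c := by
  refine ⟨fun h c hc => ?_, fun h S hS hp c hc =>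
    (h c hc).holdsAt (fun _ => FourVariableAxiom.sound) hS hp⟩
  by_contra hcon
  obtain ⟨S, hS, hSL, hSc⟩ :=
    exists_separates_of_notMem (L := {d | Deducible {J | FourVariableAxiom J} I.premise d})
      (fun J hJ hp d hd => Deducible.step J hJ (fun e he => hp he) d hd) hcon
  exact hSc (h S hS (fun d hd => hSL d (Deducible.hyp d hd)) c hc)

end GaussianCI

theorem mainTheorem7 :
    (∀ L : GaussianCI.Relation 4, GaussianCI.IsComplete L ↔
      ∀ I : GaussianCI.Implication 4, GaussianCI.FourVariableAxiom I →
        GaussianCI.Satisfies L I) ∧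
    (∀ I : GaussianCI.Implication 4, GaussianCI.FourVariableAxiom I →
      GaussianCI.IsCIImplication I) ∧
    (∀ I : GaussianCI.Implication 4, GaussianCI.IsCIImplication I ↔
      Disjoint I.premise I.conclusion ∧
        ∀ c ∈ I.conclusion,
          GaussianCI.Deducible {J | GaussianCI.FourVariableAxiom J} I.premise c) :=
  ⟨GaussianCI.isComplete_iff,
    fun _ hI => GaussianCI.isCIImplication_iff.2 ⟨hI.disjoint, hI.sound⟩,
    fun I => GaussianCI.isCIImplication_iff.trans
      (and_congr_right fun _ => GaussianCI.sound_iff_deducible I)⟩
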